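/- There are universal constants $c, C > 0$ such that the following holds for every $n$. Let $\mu$ be a probability measure on $\mathbb{R}^n$, and let $Q \subset \mathbb{R}^n$ and $\alpha > 0$ be such that one of the following two sets of assumptions is satisfied. (1) $Q$ is a cube of sidelength $\ell > 0$ parallel to the axes (a translate of $(0,\ell)^n$ or of its closure), $M \ge 0$, the measure $\mu$ is supported on $Q$ with density $e^{-\psi}$ with respect to Lebesgue measure, where $\psi : Q \to \mathbb{R}$ is convex, for all $i = 1,\dots,n$ the pure second derivative $\partial^{ii}\psi$ exists and satisfies $\partial^{ii}\psi \le M$ at all points of the interior of $Q$, and $\alpha = 3 \ell e^{M\ell^2/8}$. (2) $Q$ is a cube of sidelength $1$ parallel to the axes, $R \ge 1$, the measure $\mu$ is supported on $Q$ with a log-concave density $\rho : Q \to [0,\infty)$ such that $$ \rho(\lambda x + (1-\lambda) y) \le R\,[\lambda \rho(x) + (1-\lambda)\rho(y)] $$ for all $0 < \lambda < 1$ and all $x, y \in Q$ for which $x - y$ has at most one non-zero entry, and $\alpha = 3R$. Then every $f : Q \to \mathbb{R}$ with $|f(x) - f(y)| \le |x-y|$ for all $x, y \in Q$ (Euclidean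 norm) is $\mu$-integrable, and with $E = \int_Q f\,d\mu$, $$ \mu\{x \in Q : |f(x) - E| \ge t\} \le C e^{-c t^2/\alpha^2} \qquad \text{for all } t > 0. $$ Moreover, the covariance matrix of $\mu$ satisfies $\mathrm{Cov}(\mu) \le C\alpha^2 \cdot \mathrm{Id}$ in the sense of symmetric matrices. -/

import Mathlib

open MeasureTheory ProbabilityTheory Set

noncomputable section

/-- `Q` is a cube in `ℝⁿ` of sidelength `ℓ` parallel to the axes: a translate of `(0, ℓ)ⁿ`
or of its closure. -/
def IsAxisCube {n : ℕ} (ℓ : ℝ) (Q : Set (EuclideanSpace ℝ (Fin n))) : Prop :=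
  ∃ a : EuclideanSpace ℝ (Fin n),
    Q = {x | ∀ i, x i ∈ Ioo (a i) (a i + ℓ)} ∨ Q = {x | ∀ i, x i ∈ Icc (a i) (a i + ℓ)}

/-- `μ` is the measure carried by `Q` that has density `f` there with respect to Lebesgue
measure. -/
def HasDensityOn {n : ℕ} (μ : Measure (EuclideanSpace ℝ (Fin n)))
    (Q : Set (EuclideanSpace ℝ (Fin n))) (f : EuclideanSpace ℝ (Fin n) → ℝ) : Prop :=
  μ = (volume.restrict Q).withDensity (fun x => ENNReal.ofReal (f x))

/-- The first partial derivative `∂ⁱ ψ` at `x`. -/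
def partialDeriv {n : ℕ} (i : Fin n) (ψ : EuclideanSpace ℝ (Fin n) → ℝ)
    (x : EuclideanSpace ℝ (Fin n)) : ℝ :=
  lineDeriv ℝ ψ x (EuclideanSpace.single i 1)

/-- The pure second derivatives `∂ⁱⁱ ψ` exist at all interior points of `Q` and are at most `M`
there. -/
def PureSecondDerivLE {n : ℕ} (M : ℝ) (Q : Set (EuclideanSpace ℝ (Fin n)))
    (ψ : EuclideanSpace ℝ (Fin n) → ℝ) : Prop :=
  ∀ x ∈ interior Q, ∀ i : Fin n,
    LineDifferentiableAt ℝ ψ x (EuclideanSpace.single i 1) ∧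
    LineDifferentiableAt ℝ (partialDeriv i ψ) x (EuclideanSpace.single i 1) ∧
    partialDeriv i (partialDeriv i ψ) x ≤ M

/-- `f` is a nonnegative log-concave function on `Q`, that is, `-log f` is convex as a function
with values in `(-∞, ∞]`; zeros of `f` are allowed. -/
def IsLogConcaveOn {n : ℕ} (Q : Set (EuclideanSpace ℝ (Fin n)))
    (f : EuclideanSpace ℝ (Fin n) → ℝ) : Prop :=
  Convex ℝ Q ∧ (∀ x ∈ Q, 0 ≤ f x) ∧
  ∀ x ∈ Q, ∀ y ∈ Q, ∀ r : ℝ, 0 < r → r < 1 →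
    f x ^ r * f y ^ (1 - r) ≤ f (r • x + (1 - r) • y)

/-- `v` is proportional to a standard unit vector: it has at most one nonzero entry. -/
def IsAxisVector {n : ℕ} (v : EuclideanSpace ℝ (Fin n)) : Prop :=
  {i | v i ≠ 0}.Subsingleton

/-- `f` is convex up to the factor `R` along all segments in `Q` parallel to an axis. -/
def AxisConvexUpTo {n : ℕ} (R : ℝ) (Q : Set (EuclideanSpace ℝ (Fin n)))
    (f : EuclideanSpace ℝ (Fin n) → ℝ) : Prop :=
  ∀ x ∈ Q, ∀ y ∈ Q, IsAxisVector (x - y) → ∀ r : ℝ, 0 < r → r < 1 →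
    f (r • x + (1 - r) • y) ≤ R * (r * f x + (1 - r) * f y)

/-- The covariance matrix of a probability measure on `ℝⁿ`. -/
def covMatrix {n : ℕ} (μ : Measure (EuclideanSpace ℝ (Fin n))) : Matrix (Fin n) (Fin n) ℝ :=
  Matrix.of fun i j => cov[fun x => x i, fun x => x j; μ]

end

/-!
The theorem follows from a transport inequality for the triangular (Knothe) map, proved by
induction on the dimension. No smoothness of the transport map is needed except along lines, where
it is the monotone rearrangement.

On an interval of length at most `ℓ`, let `P` be a density that is convex up to the factor `R`, let
`T` be an increasing bijection of the interval and `τ = T - x`. Then `∫ (τ' - log (1 + τ')) P` is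
at least `∫ τ² P / (32 R ℓ²)`; this is `integral_sq_displacement_le`. If `T` transports
`P` to `G` and the logarithm of `G` lies below the tangents of `log P`, up to an error `H / P` and
the quadratic term `(y - x)² / (32 R ℓ²)`, then integrating this bound at the pairs `(x, T x)`,
and integrating `P' τ` by parts, turns the error into a bound for `∫ G`
(`oneDim_transport_functional`). The hypothesis is affine in the derivative of the density and in
the error, hence survives integration over the other coordinates, as does convexity up to a factor
along the axes. This gives the inequality on boxes in any dimension, `transport_functional`.

For a log-concave `ρ` and `g = ρ exp φ`, the tangent condition reduces to
`φ y ≤ h x + |x - y|² / (32 R ℓ²)`, and the conclusion is `∫ ρ exp φ ≤ exp (∫ ρ h)` when `∫ ρ = 1`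
(`logConcave_transport_Ioo`). The density may vanish on part of the cube. It is nevertheless
Lipschitz on smaller cubes (`exists_lipschitzOnWith`), so that Rademacher's theorem provides the
tangents, and the zeros are handled by an approximation in `logConcave_transport_of_lipschitzWith`.
For a Lipschitz function `f`, taking `φ = s f` and `h = s f + 8 R ℓ² s²` shows that `f` is
sub-Gaussian with variance proxy `16 R ℓ²`, from which both conclusions follow.

The density `exp (-ψ)` with `∂ⁱⁱψ ≤ M` is convex up to the factor `R = exp (M ℓ² / 8)` along the
axes, because `ψ` is concave along them up to the additive constant `M ℓ² / 8`.
-/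

/-! ### A weighted Poincaré-type inequality on an interval -/

/-- The tangent-line bound for `s - 1 - log s`, in the form dual to its Legendre transform. -/
lemma mul_sub_sq_le_sub_one_sub_log {s w : ℝ} (hs : 0 < s) (hw : |w| ≤ 1 / 2) :
    (s - 1) * w - 2 * w ^ 2 ≤ s - 1 - Real.log s := by
  obtain ⟨h1, h2⟩ := abs_le.1 hw
  have hw1 : 0 < 1 - w := by linarith
  have e1 := Real.log_le_sub_one_of_pos (mul_pos hs hw1)
  rw [Real.log_mul hs.ne' hw1.ne'] at e1
  have e2 := Real.one_sub_inv_le_log_of_pos hw1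
  have e3 : (1 - w)⁻¹ ≤ 1 + w + 2 * w ^ 2 := by
    rw [inv_le_iff_one_le_mul₀ hw1]
    nlinarith [mul_nonneg (sq_nonneg w) (by linarith : (0 : ℝ) ≤ 1 - 2 * w)]
  nlinarith

/-- On a subinterval `[s, t]`, the transport cost is at least a multiple of the quadratic
displacement, up to boundary terms. The point `x₀` is arbitrary in `[a, b]`. The bound
`mul_sub_sq_le_sub_one_sub_log` is applied with `w = (x₀ - x) (T x - x) / (8 ℓ²)`, which makes its
linear part a derivative up to a multiple of `(T x - x)²`. -/
lemma boundary_add_integral_sq_le {a b ℓ x₀ s t : ℝ} {T T' : ℝ → ℝ} (hab : a < b)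
    (hℓ : b - a ≤ ℓ) (hx₀ : x₀ ∈ Icc a b) (has : a ≤ s) (hst : s ≤ t) (htb : t ≤ b)
    (hT : ∀ x, HasDerivAt T (T' x) x) (hT'c : Continuous T') (hT'pos : ∀ x, 0 < T' x)
    (hTm : ∀ x ∈ Icc a b, T x ∈ Icc a b) :
    (x₀ - t) / (16 * ℓ ^ 2) * (T t - t) ^ 2 - (x₀ - s) / (16 * ℓ ^ 2) * (T s - s) ^ 2
      + ∫ x in s..t, 1 / (32 * ℓ ^ 2) * (T x - x) ^ 2
      ≤ ∫ x in s..t, (T' x - 1 - Real.log (T' x)) := by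
  have hTc : Continuous T := continuous_iff_continuousAt.2 fun x => (hT x).continuousAt
  have hℓ0 : 0 < ℓ := by linarith
  set Φ' : ℝ → ℝ := fun x => -1 / (16 * ℓ ^ 2) * (T x - x) ^ 2
    + (x₀ - x) / (8 * ℓ ^ 2) * ((T' x - 1) * (T x - x)) with hΦ'
  have hΦ'c : Continuous Φ' := by fun_prop
  have hder : ∀ x, HasDerivAt (fun x => (x₀ - x) / (16 * ℓ ^ 2) * (T x - x) ^ 2) (Φ' x) x := by
    intro x
    have h1 := ((hasDerivAt_id x).const_sub x₀).div_const (16 * ℓ ^ 2)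
    have h2 := ((hT x).sub (hasDerivAt_id x)).pow 2
    refine (h1.mul h2).congr_deriv ?_
    simp only [hΦ', Pi.sub_apply, Pi.pow_apply, id]
    field_simp
    norm_num
    ring
  have hint : ∫ x in s..t, Φ' x = (x₀ - t) / (16 * ℓ ^ 2) * (T t - t) ^ 2
      - (x₀ - s) / (16 * ℓ ^ 2) * (T s - s) ^ 2 :=
    intervalIntegral.integral_eq_sub_of_hasDerivAt (fun x _ => hder x)
      (hΦ'c.intervalIntegrable _ _)
  have hlogc : Continuous fun x => Real.log (T' x) := hT'c.log fun x => (hT'pos x).ne'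
  have hDc : Continuous fun x => 1 / (32 * ℓ ^ 2) * (T x - x) ^ 2 := by fun_prop
  rw [← hint, ← intervalIntegral.integral_add (hΦ'c.intervalIntegrable _ _)
    (hDc.intervalIntegrable _ _)]
  refine intervalIntegral.integral_mono_on hst ((hΦ'c.add hDc).intervalIntegrable _ _)
    (((hT'c.sub continuous_const).sub hlogc).intervalIntegrable _ _) ?_
  intro x hx
  have hxI : x ∈ Icc a b := ⟨has.trans hx.1, hx.2.trans htb⟩
  have hTx := hTm x hxI
  have hτ : |T x - x| ≤ ℓ := by
    rw [abs_le]; constructor <;> linarith [hTx.1, hTx.2, hxI.1, hxI.2]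
  have hd : |x₀ - x| ≤ ℓ := by
    rw [abs_le]; constructor <;> linarith [hx₀.1, hx₀.2, hxI.1, hxI.2]
  have hprod : |(x₀ - x) * (T x - x)| ≤ ℓ ^ 2 := by
    rw [abs_mul, sq]; exact mul_le_mul hd hτ (abs_nonneg _) hℓ0.le
  have hw : |(x₀ - x) / (8 * ℓ ^ 2) * (T x - x)| ≤ 1 / 2 := by
    rw [div_mul_eq_mul_div, abs_div, abs_of_pos (by positivity : (0 : ℝ) < 8 * ℓ ^ 2),
      div_le_iff₀ (by positivity)]
    nlinarith
  refine le_trans ?_ (mul_sub_sq_le_sub_one_sub_log (hT'pos x) hw)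
  have hd2 : (x₀ - x) ^ 2 ≤ ℓ ^ 2 := sq_le_sq' (by linarith [abs_le.1 hd]) (abs_le.1 hd).2
  have key : 2 * ((x₀ - x) / (8 * ℓ ^ 2) * (T x - x)) ^ 2
      ≤ 1 / (32 * ℓ ^ 2) * (T x - x) ^ 2 := by
    have : 2 * ((x₀ - x) / (8 * ℓ ^ 2) * (T x - x)) ^ 2
        = ((x₀ - x) ^ 2 / ℓ ^ 2) * (1 / (32 * ℓ ^ 2) * (T x - x) ^ 2) := by
      field_simp; ring
    rw [this]
    refine mul_le_of_le_one_left (by positivity) ?_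
    rw [div_le_one (by positivity)]; exact hd2
  have e : -1 / (16 * ℓ ^ 2) * (T x - x) ^ 2 + 2 * (1 / (32 * ℓ ^ 2) * (T x - x) ^ 2) = 0 := by
    field_simp; ring
  simp only [hΦ']
  nlinarith

/-- Layer-cake comparison of two measures whose superlevel-set masses are comparable. -/
lemma lintegral_le_lintegral_of_superlevel {X : Type*} [MeasurableSpace X] {ν₁ ν₂ : Measure X}
    {P : X → ℝ} {R : ℝ} (hR : 0 ≤ R) (hP : Measurable P) (hP0 : ∀ x, 0 ≤ P x)
    (h : ∀ u : ℝ, 0 < u → ν₁ {x | u < P x} ≤ ν₂ {x | u ≤ R * P x}) :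
    ∫⁻ x, ENNReal.ofReal (P x) ∂ν₁ ≤ ∫⁻ x, ENNReal.ofReal (R * P x) ∂ν₂ := by
  rw [lintegral_eq_lintegral_meas_lt ν₁ (Filter.Eventually.of_forall hP0) hP.aemeasurable,
    lintegral_eq_lintegral_meas_le ν₂
      (Filter.Eventually.of_forall fun x => mul_nonneg hR (hP0 x))
      (hP.const_mul R).aemeasurable]
  refine lintegral_mono_ae ?_
  filter_upwards [ae_restrict_mem measurableSet_Ioi] with u hu using h u hu

/-- If `A` dominates `D` in integral over all intervals `[a, s]` with `s ≤ x₀` and `[s, b]` with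
`x₀ ≤ s`, and if `P` decreases up to the factor `R` on `[a, x₀]` and increases up to the factor
`R` on `[x₀, b]`, then `A P` dominates `D P` in integral up to the factor `R`. -/
lemma integral_mul_le_of_tails {a b x₀ R : ℝ} {A D P : ℝ → ℝ} (hx₀ : x₀ ∈ Icc a b)
    (hR : 0 ≤ R) (hA : Continuous A) (hD : Continuous D) (hP : Continuous P)
    (hA0 : ∀ x, 0 ≤ A x) (hD0 : ∀ x, 0 ≤ D x) (hP0 : ∀ x, 0 ≤ P x)
    (hl : ∀ s ∈ Icc a x₀, ∫ x in a..s, D x ≤ ∫ x in a..s, A x)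
    (hr : ∀ s ∈ Icc x₀ b, ∫ x in s..b, D x ≤ ∫ x in s..b, A x)
    (hPl : ∀ x ∈ Icc a x₀, ∀ z ∈ Icc a x₀, x ≤ z → P z ≤ R * P x)
    (hPr : ∀ z ∈ Icc x₀ b, ∀ y ∈ Icc x₀ b, z ≤ y → P z ≤ R * P y) :
    ∫ x in a..b, D x * P x ≤ R * ∫ x in a..b, A x * P x := by
  -- the two one-sided statements are instances of one statement about a subinterval
  have half : ∀ c d : ℝ, c ≤ d →
      (∀ u : ℝ, 0 < u → ∃ p q, Icc c d ∩ {x | u < P x} ⊆ Icc p q ∧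
        (∀ x ∈ Ioo p q, u ≤ R * P x) ∧
        (p ≤ q → c ≤ p ∧ q ≤ d ∧ ∫ x in p..q, D x ≤ ∫ x in p..q, A x)) →
      ∫ x in c..d, D x * P x ≤ R * ∫ x in c..d, A x * P x := by
    intro c d hcd hu
    set ν : (ℝ → ℝ) → Measure ℝ :=
      fun F => (volume.restrict (Icc c d)).withDensity fun x => ENNReal.ofReal (F x) with hν
    have hνI : ∀ F : ℝ → ℝ, Continuous F → (∀ x, 0 ≤ F x) → ∀ p q, c ≤ p → p ≤ q → q ≤ d →
        ν F (Icc p q) = ENNReal.ofReal (∫ x in p..q, F x) := by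
      intro F hF hF0 p q hcp hpq hqd
      rw [hν, withDensity_apply _ measurableSet_Icc,
        Measure.restrict_restrict measurableSet_Icc,
        inter_eq_left.2 (Icc_subset_Icc hcp hqd), intervalIntegral.integral_of_le hpq,
        ← integral_Icc_eq_integral_Ioc,
        ofReal_integral_eq_lintegral_ofReal hF.continuousOn.integrableOn_Icc
          (Filter.Eventually.of_forall hF0)]
    have hνint : ∀ (F : ℝ → ℝ) (r : ℝ), Continuous F → (∀ x, 0 ≤ F x) → 0 ≤ r →
        ∫⁻ x, ENNReal.ofReal (r * P x) ∂(ν F) = ENNReal.ofReal (r * ∫ x in c..d, F x * P x) := by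
      intro F r hF hF0 hr0
      have hFP : Continuous fun x => r * (F x * P x) := by fun_prop
      rw [hν, lintegral_withDensity_eq_lintegral_mul _ (by fun_prop) (by fun_prop),
        intervalIntegral.integral_of_le hcd, ← integral_Icc_eq_integral_Ioc,
        ← integral_const_mul, ofReal_integral_eq_lintegral_ofReal
          hFP.continuousOn.integrableOn_Icc
          (Filter.Eventually.of_forall fun x => mul_nonneg hr0 (mul_nonneg (hF0 x) (hP0 x)))]
      refine lintegral_congr fun x => ?_
      rw [Pi.mul_apply, ← ENNReal.ofReal_mul (hF0 x)]
      congr 1; ring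
    have hνsupp : ∀ F : ℝ → ℝ, ν F (Icc c d)ᶜ = 0 := by
      intro F
      rw [hν, withDensity_apply _ measurableSet_Icc.compl,
        Measure.restrict_restrict measurableSet_Icc.compl]
      simp
    have hcmp := lintegral_le_lintegral_of_superlevel (ν₁ := ν D) (ν₂ := ν A) hR hP.measurable
      hP0 (by
        intro u hu0
        obtain ⟨p, q, hsub, hlev, hle⟩ := hu u hu0
        have h1 : ν D {x | u < P x} ≤ ν D (Icc p q) := by
          calc ν D {x | u < P x} ≤ ν D ((Icc c d ∩ {x | u < P x}) ∪ (Icc c d)ᶜ) := by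
                refine measure_mono fun x hx => ?_
                by_cases hxI : x ∈ Icc c d
                · exact Or.inl ⟨hxI, hx⟩
                · exact Or.inr hxI
            _ ≤ ν D (Icc c d ∩ {x | u < P x}) + ν D (Icc c d)ᶜ := measure_union_le _ _
            _ ≤ ν D (Icc p q) := by rw [hνsupp, add_zero]; exact measure_mono hsub
        refine h1.trans ?_
        rcases lt_or_ge q p with hpq | hpq
        · rw [Icc_eq_empty (not_le.2 hpq), measure_empty]; exact zero_le
        obtain ⟨hcp, hqd, hle⟩ := hle hpq
        rw [hνI D hD hD0 p q hcp hpq hqd]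
        refine (ENNReal.ofReal_le_ofReal hle).trans ?_
        rw [← hνI A hA hA0 p q hcp hpq hqd]
        have hac : ν A ≪ volume :=
          (withDensity_absolutelyContinuous _ _).trans Measure.absolutelyContinuous_restrict
        rw [← measure_congr (hac.ae_eq (Ioo_ae_eq_Icc (a := p) (b := q)))]
        exact measure_mono hlev)
    have e1 := hνint D 1 hD hD0 zero_le_one
    simp only [one_mul] at e1
    rw [e1, hνint A R hA hA0 hR] at hcmp
    refine (ENNReal.ofReal_le_ofReal_iff ?_).1 hcmp
    exact mul_nonneg hR (intervalIntegral.integral_nonneg hcd fun x _ =>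
      mul_nonneg (hA0 x) (hP0 x))
  have hDP : Continuous fun x => D x * P x := by fun_prop
  have hAP : Continuous fun x => A x * P x := by fun_prop
  rw [← intervalIntegral.integral_add_adjacent_intervals (b := x₀)
      (hDP.intervalIntegrable _ _) (hDP.intervalIntegrable _ _),
    ← intervalIntegral.integral_add_adjacent_intervals (b := x₀)
      (hAP.intervalIntegrable _ _) (hAP.intervalIntegrable _ _), mul_add]
  refine add_le_add (half a x₀ hx₀.1 fun u hu => ?_) (half x₀ b hx₀.2 fun u hu => ?_)
  · rcases (Icc a x₀ ∩ {x | u < P x}).eq_empty_or_nonempty with he | hne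
    · exact ⟨1, 0, by simp [he], by simp, by norm_num⟩
    have hbdd : BddAbove (Icc a x₀ ∩ {x | u < P x}) := ⟨x₀, fun x hx => hx.1.2⟩
    have hq : sSup (Icc a x₀ ∩ {x | u < P x}) ≤ x₀ := csSup_le hne fun x hx => hx.1.2
    refine ⟨a, sSup (Icc a x₀ ∩ {x | u < P x}), fun x hx => ⟨hx.1.1, le_csSup hbdd hx⟩,
      fun x hx => ?_, fun h => ⟨le_rfl, hq, hl _ ⟨h, hq⟩⟩⟩
    obtain ⟨z, hz, hxz⟩ := exists_lt_of_lt_csSup hne hx.2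
    exact hz.2.le.trans (hPl x ⟨hx.1.le, (hx.2.le.trans hq)⟩ z hz.1 hxz.le)
  · rcases (Icc x₀ b ∩ {x | u < P x}).eq_empty_or_nonempty with he | hne
    · exact ⟨1, 0, by simp [he], by simp, by norm_num⟩
    have hbdd : BddBelow (Icc x₀ b ∩ {x | u < P x}) := ⟨x₀, fun x hx => hx.1.1⟩
    have hp : x₀ ≤ sInf (Icc x₀ b ∩ {x | u < P x}) := le_csInf hne fun x hx => hx.1.1
    refine ⟨sInf (Icc x₀ b ∩ {x | u < P x}), b, fun x hx => ⟨csInf_le hbdd hx, hx.1.2⟩,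
      fun x hx => ?_, fun h => ⟨hp, le_rfl, hr _ ⟨hp, h⟩⟩⟩
    obtain ⟨z, hz, hzx⟩ := exists_lt_of_csInf_lt hne hx.1
    exact hz.2.le.trans (hPr z hz.1 x ⟨hp.trans hx.1.le, hx.2.le⟩ hzx.le)

/-- The weighted Poincaré-type inequality behind the concentration estimate: if the positive
weight `P` is convex up to the factor `R`, the transport cost `T' - 1 - log T'` controls the
quadratic displacement. The proof only uses that, up to the factor `R`, `P` decreases to the left
of a minimum point and increases to the right of it. -/
theorem integral_sq_displacement_le {a b ℓ R : ℝ} {P T T' : ℝ → ℝ} (hab : a < b)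
    (hℓ : b - a ≤ ℓ) (hR : 1 ≤ R) (hP : Continuous P) (hPpos : ∀ x, 0 < P x)
    (hPR : ∀ s ∈ Icc a b, ∀ t ∈ Icc a b, ∀ r : ℝ, 0 < r → r < 1 →
      P (r * s + (1 - r) * t) ≤ R * (r * P s + (1 - r) * P t))
    (hT : ∀ x, HasDerivAt T (T' x) x) (hT'c : Continuous T') (hT'pos : ∀ x, 0 < T' x)
    (hTa : T a = a) (hTb : T b = b) :
    1 / (32 * R * ℓ ^ 2) * ∫ x in a..b, (T x - x) ^ 2 * P x
      ≤ ∫ x in a..b, (T' x - 1 - Real.log (T' x)) * P x := by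
  have hTc : Continuous T := continuous_iff_continuousAt.2 fun x => (hT x).continuousAt
  have hℓ0 : 0 < ℓ := by linarith
  have hR0 : 0 < R := by linarith
  have hmono : StrictMono T := strictMono_of_deriv_pos fun x => by rw [(hT x).deriv]; exact hT'pos x
  have hTm : ∀ x ∈ Icc a b, T x ∈ Icc a b := fun x hx =>
    ⟨hTa ▸ hmono.monotone hx.1, (hmono.monotone hx.2).trans_eq hTb⟩
  obtain ⟨x₀, hx₀, hmin⟩ := isCompact_Icc.exists_isMinOn (nonempty_Icc.2 hab.le) hP.continuousOn
  -- convexity up to the factor `R`, between a point and the minimum point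
  have hcmp : ∀ x ∈ Icc a b, ∀ r : ℝ, 0 ≤ r → r ≤ 1 → P (r * x + (1 - r) * x₀) ≤ R * P x := by
    intro x hx r hr0 hr1
    have hm : P x₀ ≤ P x := hmin hx
    have hPx := hPpos x
    rcases hr0.eq_or_lt with rfl | hr0
    · simp only [zero_mul, sub_zero, one_mul, zero_add]; nlinarith
    rcases hr1.eq_or_lt with rfl | hr1
    · simp only [one_mul, sub_self, zero_mul, add_zero]; nlinarith
    refine (hPR x hx x₀ hx₀ r hr0 hr1).trans (mul_le_mul_of_nonneg_left ?_ hR0.le)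
    nlinarith
  have hbetween : ∀ x ∈ Icc a b, ∀ z, (x ≤ z ∧ z ≤ x₀) ∨ (x₀ ≤ z ∧ z ≤ x) →
      P z ≤ R * P x := by
    intro x hx z hz
    have : z ∈ segment ℝ x x₀ := by
      rw [segment_eq_uIcc]
      rcases hz with ⟨h1, h2⟩ | ⟨h1, h2⟩
      · exact mem_uIcc_of_le h1 h2
      · exact mem_uIcc_of_ge h1 h2
    obtain ⟨r, q, hr, hq, hrq, rfl⟩ := this
    have hq' : q = 1 - r := by linarith
    subst hq'
    exact hcmp x hx r hr (by linarith)
  have hlog : Continuous fun x => T' x - 1 - Real.log (T' x) :=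
    (hT'c.sub continuous_const).sub (hT'c.log fun x => (hT'pos x).ne')
  have hmain := integral_mul_le_of_tails (A := fun x => T' x - 1 - Real.log (T' x))
    (D := fun x => 1 / (32 * ℓ ^ 2) * (T x - x) ^ 2) (P := P) (R := R) hx₀ hR0.le hlog
    (by fun_prop) hP
    (fun x => by linarith [Real.log_le_sub_one_of_pos (hT'pos x)])
    (fun x => by positivity) (fun x => (hPpos x).le)
    (by
      intro s hs
      have h := boundary_add_integral_sq_le hab hℓ hx₀ le_rfl hs.1 (hs.2.trans hx₀.2) hT hT'c
        hT'pos hTm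
      rw [hTa, sub_self, zero_pow two_ne_zero, mul_zero, sub_zero] at h
      have : 0 ≤ (x₀ - s) / (16 * ℓ ^ 2) * (T s - s) ^ 2 :=
        mul_nonneg (div_nonneg (by linarith [hs.2]) (by positivity)) (sq_nonneg _)
      linarith)
    (by
      intro s hs
      have h := boundary_add_integral_sq_le hab hℓ hx₀ (hx₀.1.trans hs.1) hs.2 le_rfl hT hT'c
        hT'pos hTm
      rw [hTb, sub_self, zero_pow two_ne_zero, mul_zero, zero_sub] at h
      have : 0 ≤ (s - x₀) / (16 * ℓ ^ 2) * (T s - s) ^ 2 :=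
        mul_nonneg (div_nonneg (by linarith [hs.1]) (by positivity)) (sq_nonneg _)
      have e : (x₀ - s) / (16 * ℓ ^ 2) * (T s - s) ^ 2
        = -((s - x₀) / (16 * ℓ ^ 2) * (T s - s) ^ 2) := by ring
      linarith)
    (fun x hx z hz hxz => hbetween x ⟨hx.1, hx.2.trans hx₀.2⟩ z (Or.inl ⟨hxz, hz.2⟩))
    (fun z hz y hy hzy => hbetween y ⟨hx₀.1.trans hy.1, hy.2⟩ z (Or.inr ⟨hz.1, hzy⟩))
  have e : 1 / (32 * R * ℓ ^ 2) * ∫ x in a..b, (T x - x) ^ 2 * P x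
      = 1 / R * ∫ x in a..b, 1 / (32 * ℓ ^ 2) * (T x - x) ^ 2 * P x := by
    simp_rw [mul_assoc (1 / (32 * ℓ ^ 2))]
    rw [intervalIntegral.integral_const_mul, ← mul_assoc]
    congr 1; field_simp
  rw [e, one_div, inv_mul_le_iff₀ hR0]
  exact hmain

/-! ### Monotone transport on the line -/

/-- The primitive of a continuous function bounded below by a positive constant, as an order
isomorphism of the line. -/
lemma exists_orderIso_primitive {a ε : ℝ} {P : ℝ → ℝ} (hε : 0 < ε) (hP : Continuous P)
    (hPε : ∀ x, ε ≤ P x) :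
    ∃ Φ : ℝ ≃o ℝ, (∀ x, Φ x = ∫ t in a..x, P t) ∧ ∀ x, HasDerivAt Φ (P x) x := by
  set F : ℝ → ℝ := fun x => ∫ t in a..x, P t with hF
  have hder : ∀ x, HasDerivAt F (P x) x := fun x =>
    intervalIntegral.integral_hasDerivAt_right (hP.intervalIntegrable _ _)
      (hP.stronglyMeasurableAtFilter _ _) hP.continuousAt
  have hmono : StrictMono F := strictMono_of_deriv_pos fun x => by
    rw [(hder x).deriv]; exact hε.trans_le (hPε x)
  have hcont : Continuous F := continuous_iff_continuousAt.2 fun x => (hder x).continuousAt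
  -- `F x - ε x` is monotone, which gives the limits at both ends
  have hmono' : Monotone fun x => F x - ε * x := by
    refine monotone_of_deriv_nonneg
      (fun x => ((hder x).sub ((hasDerivAt_id x).const_mul ε)).differentiableAt) fun x => ?_
    have : HasDerivAt (fun x => F x - ε * x) (P x - ε * 1) x :=
      (hder x).sub ((hasDerivAt_id x).const_mul ε)
    rw [this.deriv]; linarith [hPε x]
  have hsurj : Function.Surjective F := by
    refine hcont.surjective ?_ ?_
    · refine Filter.tendsto_atTop_mono' _ (f₁ := fun x => ε * x + F 0) ?_ ?_
      · filter_upwards [Filter.eventually_ge_atTop 0] with x hx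
        have := hmono' hx
        simp only [mul_zero, sub_zero] at this
        linarith
      · exact Filter.tendsto_atTop_add_const_right _ _
          (Filter.tendsto_id.const_mul_atTop hε)
    · refine Filter.tendsto_atBot_mono' _ (f₁ := fun x => ε * x + F 0) ?_ ?_
      · filter_upwards [Filter.eventually_le_atBot 0] with x hx
        have := hmono' hx
        simp only [mul_zero, sub_zero] at this
        linarith
      · exact Filter.tendsto_atBot_add_const_right _ _
          (Filter.tendsto_id.const_mul_atBot hε)
  exact ⟨StrictMono.orderIsoOfSurjective F hmono hsurj, fun x => rfl, hder⟩

/-- Monotone transport of the density `κ P` to the density `G` on `[a, b]`, when both have the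
same mass there. -/
lemma exists_monotone_transport {a b ε κ : ℝ} {P G : ℝ → ℝ} (hε : 0 < ε)
    (hP : Continuous P) (hPε : ∀ x, ε ≤ P x) (hG : Continuous G) (hGε : ∀ x, ε ≤ G x)
    (hmass : ∫ x in a..b, G x = κ * ∫ x in a..b, P x) :
    ∃ T : ℝ → ℝ, T a = a ∧ T b = b ∧ ∀ x, HasDerivAt T (κ * P x / G (T x)) x := by
  obtain ⟨F, hF, hFd⟩ := exists_orderIso_primitive (a := a) hε hP hPε
  obtain ⟨Ψ, hΨ, hΨd⟩ := exists_orderIso_primitive (a := a) hε hG hGε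
  refine ⟨fun x => Ψ.symm (κ * F x), ?_, ?_, fun x => ?_⟩
  · rw [Ψ.symm_apply_eq, hF, hΨ]; simp
  · rw [Ψ.symm_apply_eq, hF, hΨ, hmass]
  · have hne : G (Ψ.symm (κ * F x)) ≠ 0 := (hε.trans_le (hGε _)).ne'
    have h1 : HasDerivAt Ψ.symm (G (Ψ.symm (κ * F x)))⁻¹ (κ * F x) :=
      HasDerivAt.of_local_left_inverse Ψ.symm.continuous.continuousAt (hΨd _) hne
        (Filter.Eventually.of_forall fun y => Ψ.apply_symm_apply y)
    have h2 := h1.comp x ((hFd x).const_mul κ)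
    refine h2.congr_deriv ?_
    rw [div_eq_mul_inv, mul_comm]

/-- The one-dimensional transport inequality in functional form. -/
theorem oneDim_transport_functional {a b ℓ R ε : ℝ} {K : NNReal} {P G H V : ℝ → ℝ} (hab : a < b)
    (hℓ : b - a ≤ ℓ) (hR : 1 ≤ R) (hε : 0 < ε) (hP : LipschitzWith K P) (hPε : ∀ x, ε ≤ P x)
    (hG : Continuous G) (hGε : ∀ x, ε ≤ G x) (hH : IntegrableOn H (Icc a b))
    (hPR : ∀ s ∈ Icc a b, ∀ t ∈ Icc a b, ∀ r : ℝ, 0 < r → r < 1 →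
      P (r * s + (1 - r) * t) ≤ R * (r * P s + (1 - r) * P t))
    (hV : ∀ᵐ x ∂volume.restrict (Icc a b), HasDerivAt P (V x) x ∧ ∀ y ∈ Icc a b,
      P x * (Real.log (G y) - Real.log (P x))
        ≤ V x * (y - x) + H x + 1 / (32 * R * ℓ ^ 2) * P x * (y - x) ^ 2) :
    (∫ x in Icc a b, P x) * (Real.log (∫ x in Icc a b, G x) - Real.log (∫ x in Icc a b, P x))
      ≤ ∫ x in Icc a b, H x := by
  have hPc := hP.continuous
  have hconv : ∀ F : ℝ → ℝ, ∫ x in Icc a b, F x = ∫ x in a..b, F x := fun F => by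
    rw [intervalIntegral.integral_of_le hab.le, integral_Icc_eq_integral_Ioc]
  rw [hconv, hconv, hconv]
  have hPpos : ∀ x, 0 < P x := fun x => hε.trans_le (hPε x)
  have hGpos : ∀ x, 0 < G x := fun x => hε.trans_le (hGε x)
  have hIP : 0 < ∫ x in a..b, P x :=
    intervalIntegral.intervalIntegral_pos_of_pos (hPc.intervalIntegrable _ _) hPpos hab
  have hIG : 0 < ∫ x in a..b, G x :=
    intervalIntegral.intervalIntegral_pos_of_pos (hG.intervalIntegrable _ _) hGpos hab
  obtain ⟨κ, hκ⟩ : ∃ κ, κ = (∫ x in a..b, G x) / ∫ x in a..b, P x := ⟨_, rfl⟩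
  have hκ0 : 0 < κ := hκ ▸ div_pos hIG hIP
  obtain ⟨T, hTa, hTb, hT⟩ := exists_monotone_transport (κ := κ) hε hPc hPε hG hGε
    (a := a) (b := b) (by rw [hκ]; field_simp)
  have hTc : Continuous T := continuous_iff_continuousAt.2 fun x => (hT x).continuousAt
  set T' : ℝ → ℝ := fun x => κ * P x / G (T x) with hT'
  have hT'c : Continuous T' := by
    have : ∀ x, G (T x) ≠ 0 := fun x => (hGpos _).ne'
    fun_prop (disch := assumption)
  have hT'pos : ∀ x, 0 < T' x := fun x => div_pos (mul_pos hκ0 (hPpos x)) (hGpos _)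
  have hmono : StrictMono T := strictMono_of_deriv_pos fun x => by
    rw [(hT x).deriv]; exact hT'pos x
  have hTm : ∀ x ∈ Icc a b, T x ∈ Icc a b := fun x hx =>
    ⟨hTa ▸ hmono.monotone hx.1, (hmono.monotone hx.2).trans_eq hTb⟩
  have hlogc : Continuous fun x => Real.log (T' x) := hT'c.log fun x => (hT'pos x).ne'
  have hpoinc := integral_sq_displacement_le hab hℓ hR hPc hPpos hPR hT hT'c hT'pos hTa hTb
  -- integration by parts: the displacement vanishes at both ends
  have hτ : ∀ x, HasDerivAt (fun x => T x - x) (T' x - 1) x := fun x =>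
    (hT x).sub (hasDerivAt_id x)
  have hτac : AbsolutelyContinuousOnInterval (fun x => T x - x) a b := by
    refine ContDiffOn.absolutelyContinuousOnInterval (ContDiff.contDiffOn ?_)
    refine contDiff_one_iff_deriv.2 ⟨fun x => (hτ x).differentiableAt, ?_⟩
    rw [funext fun x => (hτ x).deriv]
    fun_prop
  have hPac : AbsolutelyContinuousOnInterval P a b :=
    (hP.lipschitzOnWith).absolutelyContinuousOnInterval
  have hibp := hPac.integral_mul_deriv_eq_deriv_mul hτac
  rw [hTa, hTb, sub_self, sub_self, mul_zero, mul_zero, sub_zero, zero_sub,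
    intervalIntegral.integral_congr (g := fun x => P x * (T' x - 1))
      (fun x _ => by simp only [(hτ x).deriv])] at hibp
  have hderivint : IntervalIntegrable (fun x => deriv P x * (T x - x)) volume a b := by
    refine (hPac.intervalIntegrable_deriv).mul_continuousOn ?_
    fun_prop
  -- the hypothesis at the pair `(x, T x)`
  have hpt : ∀ᵐ x ∂volume.restrict (Icc a b), P x * Real.log κ ≤
      P x * Real.log (T' x) + deriv P x * (T x - x) + H x
        + 1 / (32 * R * ℓ ^ 2) * ((T x - x) ^ 2 * P x) := by
    filter_upwards [hV, ae_restrict_mem measurableSet_Icc] with x hx hxI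
    have h := hx.2 (T x) (hTm x hxI)
    rw [hx.1.deriv]
    have hl : Real.log (T' x) = Real.log κ + Real.log (P x) - Real.log (G (T x)) := by
      rw [hT', Real.log_div (mul_pos hκ0 (hPpos x)).ne' (hGpos _).ne',
        Real.log_mul hκ0.ne' (hPpos x).ne']
    rw [hl]
    nlinarith
  have i1 : IntervalIntegrable (fun x => P x * Real.log (T' x)) volume a b :=
    (hPc.mul hlogc).intervalIntegrable _ _
  have i3 : IntervalIntegrable H volume a b := by
    rw [intervalIntegrable_iff_integrableOn_Icc_of_le hab.le]; exact hH
  have i4 : IntervalIntegrable (fun x => 1 / (32 * R * ℓ ^ 2) * ((T x - x) ^ 2 * P x))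
      volume a b := Continuous.intervalIntegrable (by fun_prop) _ _
  have hint := intervalIntegral.integral_mono_ae_restrict hab.le
    (Continuous.intervalIntegrable (by fun_prop) _ _) (((i1.add hderivint).add i3).add i4) hpt
  rw [intervalIntegral.integral_mul_const, intervalIntegral.integral_add
      ((i1.add hderivint).add i3) i4, intervalIntegral.integral_add (i1.add hderivint) i3,
    intervalIntegral.integral_add i1 hderivint, intervalIntegral.integral_const_mul] at hint
  have hsplit : ∫ x in a..b, (T' x - 1 - Real.log (T' x)) * P x
      = (∫ x in a..b, P x * (T' x - 1)) - ∫ x in a..b, P x * Real.log (T' x) := by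
    rw [← intervalIntegral.integral_sub (Continuous.intervalIntegrable (by fun_prop) _ _) i1]
    refine intervalIntegral.integral_congr fun x _ => ?_
    ring
  have hlogκ : Real.log κ
      = Real.log (∫ x in a..b, G x) - Real.log (∫ x in a..b, P x) := by
    rw [hκ, Real.log_div hIG.ne' hIP.ne']
  rw [← hlogκ]
  linarith

/-! ### Splitting off the first coordinate of a box -/

lemma preimage_cons_Icc {n : ℕ} (a b : Fin (n + 1) → ℝ) :
    (fun p : ℝ × (Fin n → ℝ) => (Fin.cons p.1 p.2 : Fin (n + 1) → ℝ)) ⁻¹' Icc a b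
      = Icc (a 0) (b 0) ×ˢ Icc (Fin.tail a) (Fin.tail b) := by
  ext p
  simp only [mem_preimage, mem_Icc, mem_prod, Pi.le_def, Fin.forall_fin_succ, Fin.cons_zero,
    Fin.cons_succ, Fin.tail]
  tauto

/-- Lebesgue measure on a box is the product of those on its first edge and on the remaining
face. -/
lemma measurePreserving_cons_Icc {n : ℕ} (a b : Fin (n + 1) → ℝ) :
    MeasurePreserving (fun p : ℝ × (Fin n → ℝ) => (Fin.cons p.1 p.2 : Fin (n + 1) → ℝ))
      ((volume.restrict (Icc (a 0) (b 0))).prod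
        (volume.restrict (Icc (Fin.tail a) (Fin.tail b)))) (volume.restrict (Icc a b)) ∧
    MeasurableEmbedding fun p : ℝ × (Fin n → ℝ) => (Fin.cons p.1 p.2 : Fin (n + 1) → ℝ) := by
  have h := (volume_preserving_piFinSuccAbove (fun _ : Fin (n + 1) => ℝ) 0).symm
  have e : ⇑(MeasurableEquiv.piFinSuccAbove (fun _ : Fin (n + 1) => ℝ) 0).symm
      = fun p : ℝ × (Fin n → ℝ) => (Fin.cons p.1 p.2 : Fin (n + 1) → ℝ) := by
    funext p
    simp [MeasurableEquiv.piFinSuccAbove, Fin.insertNthEquiv]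
  have hemb :=
    (MeasurableEquiv.piFinSuccAbove (fun _ : Fin (n + 1) => ℝ) 0).symm.measurableEmbedding
  rw [e] at h hemb
  refine ⟨?_, hemb⟩
  have h2 := h.restrict_preimage_emb hemb (Icc a b)
  rw [preimage_cons_Icc] at h2
  rwa [Measure.prod_restrict]

lemma ae_ae_cons_of_ae {n : ℕ} {a b : Fin (n + 1) → ℝ} {p : (Fin (n + 1) → ℝ) → Prop}
    (h : ∀ᵐ x ∂volume.restrict (Icc a b), p x) :
    ∀ᵐ t ∂volume.restrict (Icc (a 0) (b 0)),
      ∀ᵐ x' ∂volume.restrict (Icc (Fin.tail a) (Fin.tail b)), p (Fin.cons t x') :=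
  Measure.ae_ae_of_ae_prod ((measurePreserving_cons_Icc a b).1.quasiMeasurePreserving.ae h)

lemma integrable_cons_prod {n : ℕ} {a b : Fin (n + 1) → ℝ} {F : (Fin (n + 1) → ℝ) → ℝ}
    (h : IntegrableOn F (Icc a b)) :
    Integrable (fun p : ℝ × (Fin n → ℝ) => F (Fin.cons p.1 p.2))
      ((volume.restrict (Icc (a 0) (b 0))).prod
        (volume.restrict (Icc (Fin.tail a) (Fin.tail b)))) := by
  obtain ⟨hm, he⟩ := measurePreserving_cons_Icc a b
  exact (hm.integrable_comp_emb he).2 h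

lemma setIntegral_Icc_cons {n : ℕ} {a b : Fin (n + 1) → ℝ} {F : (Fin (n + 1) → ℝ) → ℝ}
    (h : IntegrableOn F (Icc a b)) :
    ∫ x in Icc a b, F x
      = ∫ t in Icc (a 0) (b 0), ∫ x' in Icc (Fin.tail a) (Fin.tail b), F (Fin.cons t x') := by
  obtain ⟨hm, he⟩ := measurePreserving_cons_Icc a b
  rw [← hm.integral_comp he, integral_prod _ (integrable_cons_prod h)]

lemma dist_cons_cons_le {n : ℕ} (s t : ℝ) (x y : Fin n → ℝ) :
    dist (Fin.cons s x : Fin (n + 1) → ℝ) (Fin.cons t y) ≤ max (dist s t) (dist x y) := by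
  refine (dist_pi_le_iff (le_max_of_le_left dist_nonneg)).2 fun i => ?_
  refine Fin.cases ?_ (fun j => ?_) i
  · simp
  · simpa using Or.inr (dist_le_pi_dist x y j)

/-! ### The transport inequality on a box -/

/-- Convexity up to the factor `R` along axis-parallel segments in the product of the sets `I i`.
The segments are described by letting a single coordinate vary with `Function.update`. -/
def CoordConvexUpTo {n : ℕ} (R : ℝ) (I : Fin n → Set ℝ) (ρ : (Fin n → ℝ) → ℝ) : Prop :=
  ∀ x ∈ Set.pi univ I, ∀ i, ∀ s ∈ I i, ∀ t ∈ I i, ∀ r : ℝ, 0 < r → r < 1 →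
    ρ (Function.update x i (r * s + (1 - r) * t))
      ≤ R * (r * ρ (Function.update x i s) + (1 - r) * ρ (Function.update x i t))

/-- The transport inequality in functional form, in arbitrary dimension. If `g` lies below the
tangents of `log ρ` up to `k / ρ` plus a small multiple of the squared distance, then
`∫ g` is controlled by the integral of `k`. The hypothesis is stable under integrating out
coordinates: with `x₀` and `y₀` fixed, the fibres satisfy it with `k` changed by terms whose
integrals are exactly those needed for the marginals. -/
theorem transport_functional (n : ℕ) : ∀ {a b : Fin n → ℝ} {ℓ R ε : ℝ} {K : NNReal}
    {ρ g k : (Fin n → ℝ) → ℝ} {v : (Fin n → ℝ) → Fin n → ℝ},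
    (∀ i, a i < b i) → (∀ i, b i - a i ≤ ℓ) → 1 ≤ R → 0 < ε →
    LipschitzWith K ρ → (∀ x, ε ≤ ρ x) → Continuous g → (∀ x, ε ≤ g x) →
    IntegrableOn k (Icc a b) → Measurable v → (∀ x i, |v x i| ≤ K) →
    CoordConvexUpTo R (fun i => Icc (a i) (b i)) ρ →
    (∀ᵐ x ∂volume.restrict (Icc a b),
      (∀ i, HasDerivAt (fun s => ρ (Function.update x i s)) (v x i) (x i)) ∧
      ∀ y ∈ Icc a b, ρ x * (Real.log (g y) - Real.log (ρ x))
        ≤ ∑ i, v x i * (y i - x i) + k x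
          + 1 / (32 * R * ℓ ^ 2) * ρ x * ∑ i, (y i - x i) ^ 2) →
    (∫ x in Icc a b, ρ x) * (Real.log (∫ x in Icc a b, g x) - Real.log (∫ x in Icc a b, ρ x))
      ≤ ∫ x in Icc a b, k x := by
  induction n with
  | zero =>
    intro a b ℓ R ε K ρ g k v _ _ _ _ _ _ _ _ _ _ _ _ h
    have hvol : volume.restrict (Icc a b) = Measure.dirac a := by
      rw [Subsingleton.elim b a, Icc_self, volume_pi, Measure.pi_of_empty _ a,
        Measure.restrict_singleton, Measure.dirac_apply_of_mem (mem_singleton a), one_smul]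
    rw [hvol] at h ⊢
    rw [ae_dirac_eq] at h
    have := (Filter.eventually_pure.1 h).2 a (by rw [Subsingleton.elim b a]; simp)
    simpa using this
  | succ n ih =>
    intro a b ℓ R ε K ρ g k v hab hℓ hR hε hρ hρε hg hgε hk hvm hvb hax hv
    set D := Icc (Fin.tail a) (Fin.tail b) with hD
    have hDc : IsCompact D := isCompact_Icc
    have hDfin : volume D ≠ ⊤ := hDc.measure_lt_top.ne
    have hcons : Continuous fun p : ℝ × (Fin n → ℝ) => (Fin.cons p.1 p.2 : Fin (n + 1) → ℝ) := by
      refine continuous_pi fun i => Fin.cases ?_ (fun j => ?_) i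
      · simpa using continuous_fst
      · simp only [Fin.cons_succ]; fun_prop
    have hconst : ∀ t : ℝ, Continuous fun x' : Fin n → ℝ => (Fin.cons t x' : Fin (n + 1) → ℝ) :=
      fun t => hcons.comp (by fun_prop : Continuous fun x' : Fin n → ℝ => (t, x'))
    have hfi : ∀ (F : (Fin (n + 1) → ℝ) → ℝ) (t : ℝ), Continuous F →
        IntegrableOn (fun x' => F (Fin.cons t x')) D := fun F t hF =>
      (hF.comp (hconst t)).continuousOn.integrableOn_compact hDc
    have hvi : ∀ t : ℝ, IntegrableOn (fun x' => v (Fin.cons t x') 0) D := by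
      intro t
      refine Measure.integrableOn_of_bounded (M := K) hDfin ?_ ?_
      · exact (((measurable_pi_apply 0).comp hvm).comp (hconst t).measurable).aestronglyMeasurable
      · exact Filter.Eventually.of_forall fun x' => hvb _ _
    set m : ℝ := volume.real D with hm
    have hm0 : 0 < m := by
      rw [hm, hD, Measure.real, Real.volume_Icc_pi_toReal]
      · exact Finset.prod_pos fun i _ => sub_pos.2 (hab _)
      · exact fun i => (hab _).le
    set P : ℝ → ℝ := fun t => ∫ x' in D, ρ (Fin.cons t x') with hP
    set G : ℝ → ℝ := fun t => ∫ x' in D, g (Fin.cons t x') with hG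
    set H : ℝ → ℝ := fun t => ∫ x' in D, k (Fin.cons t x') with hH
    set V : ℝ → ℝ := fun t => ∫ x' in D, v (Fin.cons t x') 0 with hV
    have hlow : ∀ (F : (Fin (n + 1) → ℝ) → ℝ), Continuous F → (∀ x, ε ≤ F x) → ∀ t : ℝ,
        ε * m ≤ ∫ x' in D, F (Fin.cons t x') := by
      intro F hF hFε t
      have := setIntegral_mono (μ := volume) (s := D) (f := fun _ => ε)
        (integrableOn_const hDfin) (hfi F t hF) fun x' => hFε _
      rwa [setIntegral_const, smul_eq_mul, mul_comm] at this
    have hlip : ∀ x' : Fin n → ℝ, LipschitzWith K fun t : ℝ => ρ (Fin.cons t x') := by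
      intro x'
      refine LipschitzWith.of_dist_le_mul fun s t => (hρ.dist_le_mul _ _).trans ?_
      refine mul_le_mul_of_nonneg_left ((dist_cons_cons_le _ _ _ _).trans ?_) K.2
      simp
    have hPlip : LipschitzWith (K * m.toNNReal) P := by
      refine LipschitzWith.of_dist_le_mul fun s t => ?_
      rw [Real.dist_eq, hP, ← integral_sub (hfi ρ s hρ.continuous) (hfi ρ t hρ.continuous)]
      have := norm_setIntegral_le_of_norm_le_const (μ := volume) (s := D)
        (f := fun x' => ρ (Fin.cons s x') - ρ (Fin.cons t x')) (C := K * dist s t)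
        hDc.measure_lt_top fun x' _ => (hlip x').dist_le_mul s t
      rw [Real.norm_eq_abs] at this
      refine this.trans_eq ?_
      rw [NNReal.coe_mul, Real.coe_toNNReal _ hm0.le, ← hm]; ring
    rw [setIntegral_Icc_cons (hρ.continuous.continuousOn.integrableOn_compact isCompact_Icc),
      setIntegral_Icc_cons (hg.continuousOn.integrableOn_compact isCompact_Icc),
      setIntegral_Icc_cons hk]
    have hkprod := integrable_cons_prod hk
    refine oneDim_transport_functional (P := P) (G := G) (H := H) (V := V) (hab 0) (hℓ 0) hR
      (mul_pos hε hm0) hPlip (hlow ρ hρ.continuous hρε) ?_ (hlow g hg hgε) ?_ ?_ ?_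
    · exact continuous_parametric_integral_of_continuous (f := fun t x' => g (Fin.cons t x'))
        (hg.comp hcons) hDc
    · exact hkprod.integral_prod_left
    · intro s hs t ht r hr0 hr1
      simp only [hP]
      rw [← integral_const_mul, ← integral_const_mul, ← integral_add
        ((hfi ρ s hρ.continuous).const_mul _) ((hfi ρ t hρ.continuous).const_mul _),
        ← integral_const_mul]
      refine setIntegral_mono_on (hfi ρ _ hρ.continuous)
        ((((hfi ρ s hρ.continuous).const_mul _).add
          ((hfi ρ t hρ.continuous).const_mul _)).const_mul _) measurableSet_Icc fun x' hx' => ?_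
      have := hax (Fin.cons s x') (by
        refine fun i _ => Fin.cases ?_ (fun j => ?_) i
        · simpa using hs
        · simpa using ⟨hx'.1 j, hx'.2 j⟩) 0 s hs t ht r hr0 hr1
      simpa only [Fin.update_cons_zero] using this
    · filter_upwards [ae_ae_cons_of_ae hv, hkprod.prod_right_ae,
        ae_restrict_mem measurableSet_Icc] with t ht hkt htI
      refine ⟨?_, fun y₀ hy₀ => ?_⟩
      · -- differentiation under the integral sign
        refine (hasDerivAt_integral_of_dominated_loc_of_lip
          (F := fun s x' => ρ (Fin.cons s x')) (F' := fun x' => v (Fin.cons t x') 0)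
          (bound := fun _ => (K : ℝ))
          Filter.univ_mem ?_ (hfi ρ t hρ.continuous) (hvi t).aestronglyMeasurable ?_
          (integrableOn_const hDfin) ?_).2
        · exact Filter.Eventually.of_forall fun s => (hfi ρ s hρ.continuous).aestronglyMeasurable
        · refine Filter.Eventually.of_forall fun x' => ?_
          have : Real.nnabs (K : ℝ) = K := by ext; simp
          rw [this]
          exact (hlip x').lipschitzOnWith
        · filter_upwards [ht] with x' hx'
          have := hx'.1 0
          simpa only [Fin.update_cons_zero, Fin.cons_zero] using this
      · -- the inductive hypothesis for the fibres over `t` and `y₀`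
        set lam := 1 / (32 * R * ℓ ^ 2) with hlam
        set k' : (Fin n → ℝ) → ℝ := fun x' => v (Fin.cons t x') 0 * (y₀ - t) + k (Fin.cons t x')
          + lam * (y₀ - t) ^ 2 * ρ (Fin.cons t x') with hk'
        have hki : IntegrableOn (fun x' => k (Fin.cons t x')) D := hkt
        have hk'i : IntegrableOn k' D :=
          (((hvi t).mul_const _).add hki).add ((hfi ρ t hρ.continuous).const_mul _)
        have := ih (a := Fin.tail a) (b := Fin.tail b) (ℓ := ℓ) (R := R) (ε := ε) (K := K)
          (ρ := fun x' => ρ (Fin.cons t x')) (g := fun x' => g (Fin.cons y₀ x')) (k := k')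
          (v := fun x' i => v (Fin.cons t x') i.succ)
          (fun i => hab _) (fun i => hℓ _) hR hε (by
            refine LipschitzWith.of_dist_le_mul fun x' y' => (hρ.dist_le_mul _ _).trans ?_
            refine mul_le_mul_of_nonneg_left ((dist_cons_cons_le _ _ _ _).trans ?_) K.2
            simp)
          (fun x' => hρε _) (hg.comp (hconst y₀)) (fun x' => hgε _) hk'i
          (measurable_pi_lambda _ fun i =>
            ((measurable_pi_apply i.succ).comp hvm).comp (hconst t).measurable)
          (fun x' i => hvb _ _)
          (by
            intro x' hx' i s hs u hu r hr0 hr1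
            have := hax (Fin.cons t x') (by
              refine fun i _ => Fin.cases ?_ (fun j => ?_) i
              · simpa using htI
              · simpa [Fin.tail] using hx' j (mem_univ _)) i.succ s hs u hu r hr0 hr1
            simpa only [← Fin.cons_update] using this)
          (by
            filter_upwards [ht] with x' hx'
            refine ⟨fun i => ?_, fun y' hy' => ?_⟩
            · have := hx'.1 i.succ
              simpa only [← Fin.cons_update, Fin.cons_succ] using this
            · have := hx'.2 (Fin.cons y₀ y') (by
                rw [← mem_preimage (f := fun p : ℝ × (Fin n → ℝ) =>
                  (Fin.cons p.1 p.2 : Fin (n + 1) → ℝ)) (a := (y₀, y')), preimage_cons_Icc]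
                exact ⟨hy₀, hy'⟩)
              rw [Fin.sum_univ_succ, Fin.sum_univ_succ] at this
              simp only [Fin.cons_zero, Fin.cons_succ] at this
              rw [hk']
              simp only
              linarith)
        refine this.trans_eq ?_
        refine (integral_add (((hvi t).mul_const _).add hki)
          ((hfi ρ t hρ.continuous).const_mul _)).trans ?_
        rw [integral_add' ((hvi t).mul_const _) hki, integral_mul_const, integral_const_mul]
        simp only [hP, hH, hV]
        ring

/-! ### Regularity of log-concave functions that are convex up to a factor along the axes -/

/-- A function that is convex up to a factor along the axes is bounded above on a box by a
multiple of the sum of its values at the vertices. -/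
lemma CoordConvexUpTo.exists_le {n : ℕ} {R : ℝ} {I : Fin n → Set ℝ} {ρ : (Fin n → ℝ) → ℝ}
    (hR : 1 ≤ R) (h : CoordConvexUpTo R I ρ) {c d : Fin n → ℝ}
    (hI : ∀ i, Icc (c i) (d i) ⊆ I i) : ∃ B : ℝ, 0 ≤ B ∧ ∀ x ∈ Icc c d, ρ x ≤ B := by
  set M : ℝ := ∑ σ : Fin n → Bool, |ρ fun i => if σ i then c i else d i| with hM
  have hM0 : 0 ≤ M := Finset.sum_nonneg fun _ _ => abs_nonneg _
  have key : ∀ S : Finset (Fin n), ∀ x ∈ Icc c d, (∀ i ∉ S, x i = c i ∨ x i = d i) →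
      ρ x ≤ R ^ S.card * M := by
    intro S
    induction S using Finset.induction_on with
    | empty =>
      intro x _ hx
      have hσ : x = fun i => if decide (x i = c i) = true then c i else d i := by
        funext i
        rcases eq_or_ne (x i) (c i) with h1 | h1
        · simp [h1]
        · simpa [h1] using (hx i (by simp)).resolve_left h1
      rw [Finset.card_empty, pow_zero, one_mul, hM]
      calc ρ x ≤ |ρ x| := le_abs_self _
        _ = |ρ fun i => if (fun j => decide (x j = c j)) i = true then c i else d i| := by
            rw [← hσ]
        _ ≤ _ := Finset.single_le_sum
            (f := fun σ : Fin n → Bool => |ρ fun i => if σ i then c i else d i|)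
            (fun _ _ => abs_nonneg _) (Finset.mem_univ _)
    | insert i S hi ih =>
      intro x hx hxS
      rw [Finset.card_insert_of_notMem hi, pow_succ]
      have hR0 : 0 ≤ R := by linarith
      have hpow : 0 ≤ R ^ S.card * M := by positivity
      by_cases hxi : x i = c i ∨ x i = d i
      · have := ih x hx fun j hj => by
          rcases eq_or_ne j i with rfl | hji
          · exact hxi
          · exact hxS j (by simp [hj, hji])
        nlinarith
      push Not at hxi
      have hc : c i ∈ Icc (c i) (d i) := ⟨le_rfl, (hx.1 i).trans (hx.2 i)⟩
      have hd : d i ∈ Icc (c i) (d i) := ⟨(hx.1 i).trans (hx.2 i), le_rfl⟩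
      have hxo : x i ∈ openSegment ℝ (c i) (d i) := by
        rw [openSegment_eq_Ioo (lt_of_le_of_ne (hx.1 i) hxi.1.symm |>.trans
          (lt_of_le_of_ne (hx.2 i) hxi.2))]
        exact ⟨lt_of_le_of_ne (hx.1 i) hxi.1.symm, lt_of_le_of_ne (hx.2 i) hxi.2⟩
      obtain ⟨r, q, hr, hq, hrq, hcomb⟩ := hxo
      have hend : ∀ s ∈ Icc (c i) (d i), (s = c i ∨ s = d i) →
          ρ (Function.update x i s) ≤ R ^ S.card * M := by
        intro s hs hs'
        refine ih _ ⟨fun j => ?_, fun j => ?_⟩ fun j hj => ?_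
        · rcases eq_or_ne j i with rfl | hji
          · simpa using hs.1
          · simpa [hji] using hx.1 j
        · rcases eq_or_ne j i with rfl | hji
          · simpa using hs.2
          · simpa [hji] using hx.2 j
        · rcases eq_or_ne j i with rfl | hji
          · simpa using hs'
          · simpa [hji] using hxS j (by simp [hj, hji])
      have hq' : q = 1 - r := by linarith
      subst hq'
      have := h x (fun j _ => hI j ⟨hx.1 j, hx.2 j⟩) i (c i) (hI i hc) (d i) (hI i hd) r hr
        (by linarith)
      have e : r * c i + (1 - r) * d i = x i := by simpa using hcomb
      rw [e, Function.update_eq_self] at this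
      refine this.trans ?_
      rw [mul_comm R, mul_right_comm]
      refine mul_le_mul_of_nonneg_right ?_ hR0
      nlinarith [hend _ hc (Or.inl rfl), hend _ hd (Or.inr rfl)]
  have hR0 : 0 ≤ R := by linarith
  exact ⟨R ^ (Finset.univ : Finset (Fin n)).card * M, by positivity,
    fun x hx => key Finset.univ x hx fun i hi => absurd (Finset.mem_univ i) hi⟩

/-- One-sided estimate behind `abs_sub_le_of_logConcave_of_convexUpTo`. If `f x < f y`, then
log-concavity forces `f` to decay geometrically beyond `x`, seen from `y`, while convexity up to
a factor bounds `f y` by its value far beyond `x` plus a linear term. -/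
lemma sub_le_of_logConcave_of_convexUpTo {f : ℝ → ℝ} {p q δ R B : ℝ} (hδ : 0 < δ) (hR : 1 ≤ R)
    (hf0 : ∀ x ∈ Icc p q, 0 ≤ f x) (hfB : ∀ x ∈ Icc p q, f x ≤ B)
    (hlc : ∀ x ∈ Icc p q, ∀ y ∈ Icc p q, ∀ r : ℝ, 0 < r → r < 1 →
      f x ^ r * f y ^ (1 - r) ≤ f (r * x + (1 - r) * y))
    (hcx : ∀ x ∈ Icc p q, ∀ y ∈ Icc p q, ∀ r : ℝ, 0 < r → r < 1 →
      f (r * x + (1 - r) * y) ≤ R * (r * f x + (1 - r) * f y))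
    {x y : ℝ} (hx : x ∈ Icc (p + δ) (q - δ)) (hy : y ∈ Icc (p + δ) (q - δ)) :
    f y - f x ≤ 2 * R * (Real.log (2 * R) + 1) * B / δ * |y - x| := by
  have hsub : Icc (p + δ) (q - δ) ⊆ Icc p q := Icc_subset_Icc (by linarith) (by linarith)
  have hfx := hf0 x (hsub hx)
  have hfyB := hfB y (hsub hy)
  have hB0 : 0 ≤ B := (hf0 y (hsub hy)).trans hfyB
  set L := Real.log (2 * R) with hL
  have hL0 : 0 < L := Real.log_pos (by linarith)
  have hC0 : 0 ≤ 2 * R * (L + 1) * B / δ := by positivity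
  rcases le_or_gt (f y) (f x) with hle | hlt
  · exact (sub_nonpos.2 hle).trans (mul_nonneg hC0 (abs_nonneg _))
  have hfy : 0 < f y := hfx.trans_lt hlt
  have hxy : x ≠ y := fun h => by simp [h] at hlt
  set t := |y - x| with ht
  have ht0 : 0 < t := abs_pos.2 (sub_ne_zero.2 hxy.symm)
  set θ := f x / f y with hθ
  have hθ0 : 0 ≤ θ := div_nonneg hfx hfy.le
  have hθ1 : θ < 1 := (div_lt_one hfy).2 hlt
  have hdiff : f y - f x = (1 - θ) * f y := by rw [hθ]; field_simp
  -- with this `s`, the point `y - s (y - x)` has value at most `f y / (2 R)`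
  set s := (L + 1) / (1 - θ) with hs
  have hsθ : s * (1 - θ) = L + 1 := div_mul_cancel₀ _ (by linarith)
  have hs1 : 1 < s := by rw [hs, lt_div_iff₀ (by linarith)]; linarith
  rw [hdiff]
  rcases lt_or_ge δ (s * t) with hst | hst
  · -- that point may lie outside the interval; then `|y - x|` is large and boundedness suffices
    have h1 : (1 - θ) * f y ≤ (1 - θ) * B := mul_le_mul_of_nonneg_left hfyB (by linarith)
    have h2 : (1 - θ) * δ ≤ (L + 1) * t := by
      calc (1 - θ) * δ ≤ (1 - θ) * (s * t) := mul_le_mul_of_nonneg_left hst.le (by linarith)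
        _ = (L + 1) * t := by rw [← hsθ]; ring
    have h3 : (1 - θ) ≤ (L + 1) * t / δ := (le_div_iff₀ hδ).2 h2
    calc (1 - θ) * f y ≤ (1 - θ) * B := h1
      _ ≤ (L + 1) * t / δ * B := mul_le_mul_of_nonneg_right h3 hB0
      _ = 1 * ((L + 1) * B / δ * t) := by ring
      _ ≤ (2 * R) * ((L + 1) * B / δ * t) :=
        mul_le_mul_of_nonneg_right (by linarith) (by positivity)
      _ = _ := by ring
  · have hyx : |s * (y - x)| ≤ δ := by rw [abs_mul, abs_of_pos (by linarith : 0 < s)]; exact hst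
    have hz : y - s * (y - x) ∈ Icc p q := by
      obtain ⟨h1, h2⟩ := abs_le.1 hyx
      constructor <;> linarith [hy.1, hy.2]
    have hde : |δ / t * (y - x)| ≤ δ := by
      rw [abs_mul, abs_of_pos (by positivity : 0 < δ / t), ← ht, div_mul_cancel₀ _ ht0.ne']
    have he : y + δ / t * (y - x) ∈ Icc p q := by
      obtain ⟨h1, h2⟩ := abs_le.1 hde
      constructor <;> linarith [hy.1, hy.2]
    set z := y - s * (y - x) with hzdef
    set e := y + δ / t * (y - x) with hedef
    have hfz := hf0 z hz
    -- decay beyond `x`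
    have hdecay : f z ≤ f y / (2 * R) := by
      have h1 := hlc z hz y (hsub hy) (1 / s) (by positivity) (by rw [div_lt_one] <;> linarith)
      have e1 : 1 / s * z + (1 - 1 / s) * y = x := by rw [hzdef]; field_simp; ring
      rw [e1] at h1
      have h2 := Real.rpow_le_rpow (by positivity) h1 (by linarith : (0 : ℝ) ≤ s)
      rw [Real.mul_rpow (by positivity) (by positivity), ← Real.rpow_mul hfz,
        ← Real.rpow_mul hfy.le, one_div_mul_cancel (by linarith), Real.rpow_one] at h2
      have e2 : f x ^ s = θ ^ s * f y * f y ^ ((1 - 1 / s) * s) := by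
        have : f x = θ * f y := by rw [hθ]; field_simp
        rw [this, Real.mul_rpow hθ0 hfy.le, mul_assoc]
        have h3 := Real.rpow_add hfy 1 ((1 - 1 / s) * s)
        rw [Real.rpow_one] at h3
        rw [← h3]
        congr 2; field_simp; ring
      rw [e2] at h2
      have h3 : f z ≤ θ ^ s * f y := le_of_mul_le_mul_right h2 (by positivity)
      refine h3.trans ?_
      rw [div_eq_inv_mul]
      refine mul_le_mul_of_nonneg_right ?_ hfy.le
      have h4 : θ ≤ Real.exp (-(1 - θ)) := by
        have := Real.add_one_le_exp (-(1 - θ)); linarith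
      calc θ ^ s ≤ Real.exp (-(1 - θ)) ^ s := Real.rpow_le_rpow hθ0 h4 (by linarith)
        _ = Real.exp (-(L + 1)) := by rw [← Real.exp_mul, ← hsθ]; congr 1; ring
        _ ≤ Real.exp (-L) := Real.exp_le_exp.2 (by linarith)
        _ = (2 * R)⁻¹ := by rw [Real.exp_neg, hL, Real.exp_log (by linarith)]
    -- convexity between `z` and a point `e` at distance `δ` on the other side of `y`
    have hden : 0 < s * t + δ := by positivity
    have h5 := hcx z hz e he (δ / (s * t + δ)) (by positivity)
      (by rw [div_lt_one hden]; nlinarith)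
    have e3 : δ / (s * t + δ) * z + (1 - δ / (s * t + δ)) * e = y := by
      rw [hzdef, hedef]; field_simp; ring
    rw [e3] at h5
    have h6 : 1 - δ / (s * t + δ) ≤ s * t / δ := by
      rw [one_sub_div hden.ne', div_le_div_iff₀ hden hδ]
      nlinarith [mul_pos (by linarith : 0 < s) ht0]
    have h7 : δ / (s * t + δ) * f z ≤ f y / (2 * R) :=
      (mul_le_of_le_one_left hfz ((div_le_one hden).2 (by nlinarith))).trans hdecay
    have h8 : (1 - δ / (s * t + δ)) * f e ≤ s * t / δ * B :=
      mul_le_mul h6 (hfB e he) (hf0 e he) (by positivity)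
    have h9 : f y ≤ f y / 2 + R * (s * t / δ * B) := by
      refine h5.trans ((mul_le_mul_of_nonneg_left (add_le_add h7 h8) (by linarith)).trans_eq ?_)
      field_simp
    have h10 : f y ≤ 2 * R * (s * t / δ * B) := by linarith
    calc (1 - θ) * f y ≤ (1 - θ) * (2 * R * (s * t / δ * B)) :=
          mul_le_mul_of_nonneg_left h10 (by linarith)
      _ = 2 * R * (s * (1 - θ)) * B / δ * t := by ring
      _ = _ := by rw [hsθ]

/-- A function on an interval that is bounded, log-concave and convex up to a factor is Lipschitz
away from the ends. -/
lemma abs_sub_le_of_logConcave_of_convexUpTo {f : ℝ → ℝ} {p q δ R B : ℝ} (hδ : 0 < δ)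
    (hR : 1 ≤ R) (hf0 : ∀ x ∈ Icc p q, 0 ≤ f x) (hfB : ∀ x ∈ Icc p q, f x ≤ B)
    (hlc : ∀ x ∈ Icc p q, ∀ y ∈ Icc p q, ∀ r : ℝ, 0 < r → r < 1 →
      f x ^ r * f y ^ (1 - r) ≤ f (r * x + (1 - r) * y))
    (hcx : ∀ x ∈ Icc p q, ∀ y ∈ Icc p q, ∀ r : ℝ, 0 < r → r < 1 →
      f (r * x + (1 - r) * y) ≤ R * (r * f x + (1 - r) * f y))
    {x y : ℝ} (hx : x ∈ Icc (p + δ) (q - δ)) (hy : y ∈ Icc (p + δ) (q - δ)) :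
    |f x - f y| ≤ 2 * R * (Real.log (2 * R) + 1) * B / δ * |x - y| := by
  have h1 := sub_le_of_logConcave_of_convexUpTo hδ hR hf0 hfB hlc hcx hx hy
  have h2 := sub_le_of_logConcave_of_convexUpTo hδ hR hf0 hfB hlc hcx hy hx
  rw [abs_sub_comm y x] at h1
  rw [abs_le]
  constructor <;> linarith

/-- A function on a box that is Lipschitz along the axes is Lipschitz. -/
lemma lipschitzOnWith_of_coord {n : ℕ} {c d : Fin n → ℝ} {ρ : (Fin n → ℝ) → ℝ} {C : ℝ}
    (hC : 0 ≤ C) (h : ∀ x ∈ Icc c d, ∀ i, ∀ s ∈ Icc (c i) (d i),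
      |ρ (Function.update x i s) - ρ x| ≤ C * |s - x i|) :
    LipschitzOnWith (n * C).toNNReal ρ (Icc c d) := by
  refine LipschitzOnWith.of_dist_le_mul fun y hy x hx => ?_
  rw [Real.coe_toNNReal _ (by positivity)]
  have hmem : ∀ S : Finset (Fin n), S.piecewise y x ∈ Icc c d := fun S =>
    ⟨fun i => by by_cases hi : i ∈ S <;> simp [hi, hx.1 i, hy.1 i],
      fun i => by by_cases hi : i ∈ S <;> simp [hi, hx.2 i, hy.2 i]⟩
  have key : ∀ S : Finset (Fin n), |ρ (S.piecewise y x) - ρ x| ≤ S.card * C * dist y x := by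
    intro S
    induction S using Finset.induction_on with
    | empty => simp
    | insert i S hi ih =>
      have h1 := h _ (hmem S) i (y i) ⟨hy.1 i, hy.2 i⟩
      rw [← Finset.piecewise_insert, Finset.piecewise_eq_of_notMem _ _ _ hi] at h1
      have h2 : |y i - x i| ≤ dist y x := by
        rw [← Real.dist_eq]; exact dist_le_pi_dist y x i
      rw [Finset.card_insert_of_notMem hi]
      push_cast
      calc |ρ ((insert i S).piecewise y x) - ρ x|
          ≤ |ρ ((insert i S).piecewise y x) - ρ (S.piecewise y x)|
            + |ρ (S.piecewise y x) - ρ x| := abs_sub_le _ _ _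
        _ ≤ C * dist y x + S.card * C * dist y x :=
          add_le_add (h1.trans (mul_le_mul_of_nonneg_left h2 hC)) ih
        _ = _ := by ring
  have := key Finset.univ
  rwa [Finset.piecewise_univ, Finset.card_univ, Fintype.card_fin, ← Real.dist_eq] at this

/-- Log-concavity on `U` of a nonnegative function of `n` real variables, with zeros allowed. -/
def CoordLogConcave {n : ℕ} (U : Set (Fin n → ℝ)) (ρ : (Fin n → ℝ) → ℝ) : Prop :=
  ∀ x ∈ U, ∀ y ∈ U, ∀ r : ℝ, 0 < r → r < 1 →
    ρ x ^ r * ρ y ^ (1 - r) ≤ ρ (r • x + (1 - r) • y)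

lemma update_combination {n : ℕ} (x : Fin n → ℝ) (i : Fin n) (r s t : ℝ) :
    r • Function.update x i s + (1 - r) • Function.update x i t
      = Function.update x i (r * s + (1 - r) * t) := by
  funext j
  rcases eq_or_ne j i with rfl | h
  · simp
  · simp [h]; ring

/-- On smaller closed boxes, a log-concave function that is convex up to a factor along the axes
is Lipschitz, in particular continuous also at the boundary of its support. -/
lemma exists_lipschitzOnWith {n : ℕ} {a b : Fin n → ℝ} {R δ : ℝ} {ρ : (Fin n → ℝ) → ℝ}
    (hδ : 0 < δ) (hR : 1 ≤ R) (hρ0 : ∀ x ∈ Set.pi univ fun i => Ioo (a i) (b i), 0 ≤ ρ x)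
    (hlc : CoordLogConcave (Set.pi univ fun i => Ioo (a i) (b i)) ρ)
    (hcx : CoordConvexUpTo R (fun i => Ioo (a i) (b i)) ρ) :
    ∃ K : NNReal, LipschitzOnWith K ρ (Icc (fun i => a i + δ) fun i => b i - δ) := by
  have hsubI : ∀ i, Icc (a i + δ / 2) (b i - δ / 2) ⊆ Ioo (a i) (b i) := fun i x hx =>
    ⟨by linarith [hx.1], by linarith [hx.2]⟩
  obtain ⟨B, hB0, hB⟩ := hcx.exists_le hR hsubI
  have hL0 : 0 < Real.log (2 * R) := Real.log_pos (by linarith)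
  refine ⟨_, lipschitzOnWith_of_coord
    (C := 2 * R * (Real.log (2 * R) + 1) * B / (δ / 2)) (by positivity) fun x hx i s hs => ?_⟩
  have hupd : ∀ u ∈ Icc (a i + δ / 2) (b i - δ / 2),
      Function.update x i u ∈ Icc (fun i => a i + δ / 2) fun i => b i - δ / 2 := by
    intro u hu
    constructor <;> intro j <;> rcases eq_or_ne j i with rfl | h
    · simpa using hu.1
    · have := hx.1 j; simp only [Function.update_of_ne h]; simp only at this; linarith
    · simpa using hu.2
    · have := hx.2 j; simp only [Function.update_of_ne h]; simp only at this; linarith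
  have hupd' : ∀ u ∈ Icc (a i + δ / 2) (b i - δ / 2),
      Function.update x i u ∈ Set.pi univ fun i => Ioo (a i) (b i) := fun u hu j _ =>
    hsubI j ⟨(hupd u hu).1 j, (hupd u hu).2 j⟩
  have hxU : x ∈ Set.pi univ fun i => Ioo (a i) (b i) := fun j _ =>
    ⟨by have := hx.1 j; simp only at this; linarith, by have := hx.2 j; simp only at this; linarith⟩
  have hs' : s ∈ Icc (a i + δ / 2 + δ / 2) (b i - δ / 2 - δ / 2) := by
    constructor <;> linarith [hs.1, hs.2]
  have hx' : x i ∈ Icc (a i + δ / 2 + δ / 2) (b i - δ / 2 - δ / 2) := by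
    have h1 := hx.1 i; have h2 := hx.2 i
    simp only at h1 h2
    constructor <;> linarith
  have := abs_sub_le_of_logConcave_of_convexUpTo (f := fun u => ρ (Function.update x i u))
    (p := a i + δ / 2) (q := b i - δ / 2) (B := B) (half_pos hδ) hR
    (fun u hu => hρ0 _ (hupd' u hu)) (fun u hu => hB _ (hupd u hu))
    (fun u hu w hw r hr0 hr1 => by
      have := hlc _ (hupd' u hu) _ (hupd' w hw) r hr0 hr1
      rwa [update_combination] at this)
    (fun u hu w hw r hr0 hr1 => hcx x hxU i u (hsubI i hu) w (hsubI i hw) r hr0 hr1) hs' hx'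
  simpa using this

/-! ### The transport inequality for log-concave densities on a closed box -/

/-- The tangent inequality for the logarithm of a log-concave function, multiplied through by the
value of the function. -/
lemma mul_log_sub_log_le_fderiv {E : Type*} [NormedAddCommGroup E] [NormedSpace ℝ E]
    {ρ : E → ℝ} {x y : E} (hd : DifferentiableAt ℝ ρ x) (hx : 0 < ρ x) (hy : 0 < ρ y)
    (h : ∀ r : ℝ, 0 < r → r < 1 → ρ y ^ r * ρ x ^ (1 - r) ≤ ρ (r • y + (1 - r) • x)) :
    ρ x * (Real.log (ρ y) - Real.log (ρ x)) ≤ fderiv ℝ ρ x (y - x) := by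
  set A := Real.log (ρ y) - Real.log (ρ x) with hA
  have h1 : HasDerivAt (fun t : ℝ => ρ (x + t • (y - x))) (fderiv ℝ ρ x (y - x)) 0 :=
    hd.hasFDerivAt.hasLineDerivAt (y - x)
  have h2 : HasDerivAt (fun t : ℝ => ρ x * Real.exp (t * A)) (ρ x * A) 0 := by
    have := (((hasDerivAt_id (0 : ℝ)).mul_const A).exp).const_mul (ρ x)
    simpa using this
  have h3 := (h1.sub h2).tendsto_slope_zero_right
  refine sub_nonneg.1 (ge_of_tendsto h3 ?_)
  filter_upwards [Ioo_mem_nhdsGT (zero_lt_one' ℝ)] with t ht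
  simp only [zero_add, Pi.sub_apply, zero_smul, add_zero, zero_mul, Real.exp_zero, mul_one,
    sub_self, sub_zero, smul_eq_mul]
  refine mul_nonneg (inv_nonneg.2 ht.1.le) (sub_nonneg.2 ?_)
  have h4 := h t ht.1 ht.2
  have e1 : t • y + (1 - t) • x = x + t • (y - x) := by
    rw [smul_sub, sub_smul, one_smul]; abel
  have e2 : ρ y ^ t * ρ x ^ (1 - t) = ρ x * Real.exp (t * A) := by
    rw [Real.rpow_def_of_pos hy, Real.rpow_def_of_pos hx, ← Real.exp_add]
    have e3 : ρ x * Real.exp (t * A) = Real.exp (Real.log (ρ x)) * Real.exp (t * A) := by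
      rw [Real.exp_log hx]
    rw [e3, ← Real.exp_add, hA]
    congr 1; ring
  rwa [e1, e2] at h4

/-- The function `p ↦ p (A - log p)` is subadditive. -/
lemma add_mul_sub_log_le {p ε : ℝ} (A : ℝ) (hp : 0 ≤ p) (hε : 0 < ε) :
    (p + ε) * (A - Real.log (p + ε)) ≤ p * (A - Real.log p) + ε * (A - Real.log ε) := by
  have h1 : Real.log ε ≤ Real.log (p + ε) := Real.log_le_log hε (by linarith)
  have h2 : p * Real.log p ≤ p * Real.log (p + ε) := by
    rcases hp.eq_or_lt with rfl | hp
    · simp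
    · exact mul_le_mul_of_nonneg_left (Real.log_le_log hp (by linarith)) hp.le
  nlinarith [mul_le_mul_of_nonneg_left h1 hε.le]

/-- The transport inequality on a closed box for a Lipschitz log-concave density, which may have
zeros. It follows from `transport_functional` for the densities `ρ + ε` and `max (ρ exp φ) ε`. The
hypothesis there fails only near the boundary of the support of `ρ`, namely where `ρ` is small but
positive, and this costs an error that tends to zero with `ε`. -/
theorem logConcave_transport_of_lipschitzWith {n : ℕ} {c d : Fin n → ℝ} {ℓ R : ℝ} {K : NNReal}
    {ρ φ h : (Fin n → ℝ) → ℝ} (hcd : ∀ i, c i < d i) (hℓ : ∀ i, d i - c i ≤ ℓ) (hR : 1 ≤ R)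
    (hρ : LipschitzWith K ρ) (hρ0 : ∀ x, 0 ≤ ρ x) (hlc : CoordLogConcave (Icc c d) ρ)
    (hcx : CoordConvexUpTo R (fun i => Icc (c i) (d i)) ρ) (hφ : Continuous φ)
    (hh : Continuous h)
    (hφh : ∀ x ∈ Icc c d, ∀ y ∈ Icc c d,
      φ y ≤ h x + 1 / (32 * R * ℓ ^ 2) * ∑ i, (y i - x i) ^ 2)
    (hpos : 0 < ∫ x in Icc c d, ρ x) :
    (∫ x in Icc c d, ρ x) * (Real.log (∫ x in Icc c d, ρ x * Real.exp (φ x))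
      - Real.log (∫ x in Icc c d, ρ x)) ≤ ∫ x in Icc c d, ρ x * h x := by
  have hρc := hρ.continuous
  have hD : IsCompact (Icc c d) := isCompact_Icc
  have hDfin : volume (Icc c d) ≠ ⊤ := hD.measure_lt_top.ne
  set lam := 1 / (32 * R * ℓ ^ 2) with hlam
  have hlam0 : 0 ≤ lam := by rw [hlam]; positivity
  set L : ℝ := K * dist c d with hL
  have hL0 : 0 ≤ L := by positivity
  have hci : ∀ {F : (Fin n → ℝ) → ℝ}, Continuous F → IntegrableOn F (Icc c d) :=
    fun hF => hF.continuousOn.integrableOn_compact hD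
  obtain ⟨B, hB⟩ : ∃ B : ℝ, ∀ x ∈ Icc c d, ρ x * Real.exp (φ x) ≤ B := by
    obtain ⟨B, hB⟩ := hD.bddAbove_image (f := fun x => ρ x * Real.exp (φ x))
      (Continuous.continuousOn (by fun_prop))
    exact ⟨B, fun x hx => hB (mem_image_of_mem _ hx)⟩
  set B' := max B 1 with hB'
  -- as `ε` decreases to zero, the second entry of the maximum tends to `-∞` wherever `0 < ρ x`
  set k₂ : ℝ → (Fin n → ℝ) → ℝ := fun ε => {x | 0 < ρ x}.indicator fun x =>
    max (ρ x * h x) (L + (ρ x * Real.log ε - ρ x * Real.log (ρ x))) with hk₂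
  have hlogc : Continuous fun x => ρ x * Real.log (ρ x) := Real.continuous_mul_log.comp hρc
  have hk₂i : ∀ ε, IntegrableOn (k₂ ε) (Icc c d) := fun ε =>
    (hci (by fun_prop)).indicator (isOpen_lt continuous_const hρc).measurableSet
  have main : ∀ ε : ℝ, 0 < ε → ε < 1 →
      (∫ x in Icc c d, (ρ x + ε)) * (Real.log (∫ x in Icc c d, max (ρ x * Real.exp (φ x)) ε)
        - Real.log (∫ x in Icc c d, (ρ x + ε)))
        ≤ ∫ x in Icc c d, (ε * (Real.log B' - Real.log ε) + k₂ ε x) := by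
    intro ε hε hε1
    refine transport_functional n (ℓ := ℓ) (R := R) (ε := ε) (K := K)
      (v := fun x i => lineDeriv ℝ ρ x (Pi.single i 1)) hcd hℓ hR hε ?_
      (fun x => by linarith [hρ0 x]) (by fun_prop) (fun x => le_max_right _ _)
      ((integrableOn_const hDfin).add (hk₂i ε)) ?_ ?_ ?_ ?_
    · refine LipschitzWith.of_dist_le_mul fun x y => ?_
      simpa using hρ.dist_le_mul x y
    · exact measurable_pi_lambda _ fun i => measurable_lineDeriv hρc
    · intro x i
      have := norm_lineDeriv_le_of_lipschitz ℝ hρ (x₀ := x) (v := Pi.single i (1 : ℝ))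
      simpa [Pi.norm_single] using this
    · intro x hx i s hs t ht r hr0 hr1
      have := hcx x hx i s hs t ht r hr0 hr1
      nlinarith
    · filter_upwards [ae_restrict_of_ae hρ.ae_differentiableAt,
        ae_restrict_mem measurableSet_Icc] with x hdx hx
      have hline : ∀ i, lineDeriv ℝ ρ x (Pi.single i 1) = fderiv ℝ ρ x (Pi.single i 1) :=
        fun i => hdx.lineDeriv_eq_fderiv
      refine ⟨fun i => ?_, fun y hy => ?_⟩
      · rw [hline]
        have h1 : HasFDerivAt ρ (fderiv ℝ ρ x) (Function.update x i (x i)) := by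
          rw [Function.update_eq_self]; exact hdx.hasFDerivAt
        have := h1.comp_hasDerivAt (x i) (hasDerivAt_update x i (x i))
        exact this.add_const ε
      have hsum : ∑ i, lineDeriv ℝ ρ x (Pi.single i 1) * (y i - x i) = fderiv ℝ ρ x (y - x) := by
        have := LinearMap.pi_apply_eq_sum_univ (fderiv ℝ ρ x).toLinearMap (y - x)
        rw [ContinuousLinearMap.coe_coe] at this
        rw [this]
        refine Finset.sum_congr rfl fun i _ => ?_
        rw [hline, smul_eq_mul, mul_comm, Pi.sub_apply]
        congr 2
        funext j
        simp [Pi.single_apply, eq_comm]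
      rw [hsum]
      have hgrad : |fderiv ℝ ρ x (y - x)| ≤ L := by
        rw [← Real.norm_eq_abs]
        refine ((fderiv ℝ ρ x).le_opNorm _).trans ?_
        refine mul_le_mul (norm_fderiv_le_of_lipschitz ℝ hρ) ?_ (norm_nonneg _) K.2
        rw [← dist_eq_norm]
        exact Real.dist_le_of_mem_pi_Icc hy hx
      have hS : 0 ≤ ∑ i, (y i - x i) ^ 2 := Finset.sum_nonneg fun i _ => sq_nonneg _
      set S := ∑ i, (y i - x i) ^ 2 with hSdef
      have hgy : Real.log (max (ρ y * Real.exp (φ y)) ε) ≤ Real.log B' :=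
        Real.log_le_log (lt_max_of_lt_right hε) (max_le_max (hB y hy) hε1.le)
      have hsub := add_mul_sub_log_le (Real.log (max (ρ y * Real.exp (φ y)) ε)) (hρ0 x) hε
      have hε' : ε * (Real.log (max (ρ y * Real.exp (φ y)) ε) - Real.log ε)
          ≤ ε * (Real.log B' - Real.log ε) := mul_le_mul_of_nonneg_left (by linarith) hε.le
      have hεS : 0 ≤ lam * ε * S := by positivity
      suffices hmain : ρ x * (Real.log (max (ρ y * Real.exp (φ y)) ε) - Real.log (ρ x))
          ≤ fderiv ℝ ρ x (y - x) + k₂ ε x + lam * ρ x * S by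
        rw [mul_add, add_mul]
        linarith
      rcases (hρ0 x).eq_or_lt with hx0 | hx0
      · -- at a zero of `ρ` the gradient vanishes
        have hmin : IsLocalMin ρ x := Filter.Eventually.of_forall fun z => by
          rw [← hx0]; exact hρ0 z
        rw [hmin.fderiv_eq_zero]
        simp [hk₂, ← hx0]
      · have hk₂x : k₂ ε x
            = max (ρ x * h x) (L + (ρ x * Real.log ε - ρ x * Real.log (ρ x))) :=
          indicator_of_mem (show x ∈ {x | 0 < ρ x} from hx0) _
        rw [hk₂x]
        have hpS : 0 ≤ lam * ρ x * S := by positivity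
        rcases le_or_gt (ρ y * Real.exp (φ y)) ε with hcase | hcase
        · rw [max_eq_right hcase]
          have := le_max_right (ρ x * h x) (L + (ρ x * Real.log ε - ρ x * Real.log (ρ x)))
          have := (abs_le.1 hgrad).1
          linarith
        · have hy0 : 0 < ρ y := pos_of_mul_pos_left (hε.trans hcase) (Real.exp_pos _).le
          rw [max_eq_left hcase.le, Real.log_mul hy0.ne' (Real.exp_pos _).ne', Real.log_exp]
          have h1 := mul_log_sub_log_le_fderiv hdx hx0 hy0
            fun r hr0 hr1 => hlc y hy x hx r hr0 hr1
          have h2 := le_max_left (ρ x * h x) (L + (ρ x * Real.log ε - ρ x * Real.log (ρ x)))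
          have h3 := mul_le_mul_of_nonneg_left (hφh x hx y hy) (hρ0 x)
          linarith
  -- passage to the limit
  have hIpos : 0 < ∫ x in Icc c d, ρ x * Real.exp (φ x) := by
    obtain ⟨m, hm⟩ := hD.bddBelow_image hφ.continuousOn
    have : ∫ x in Icc c d, ρ x * Real.exp m ≤ ∫ x in Icc c d, ρ x * Real.exp (φ x) :=
      setIntegral_mono_on (hci (by fun_prop)) (hci (by fun_prop)) measurableSet_Icc fun x hx =>
        mul_le_mul_of_nonneg_left (Real.exp_le_exp.2 (hm (mem_image_of_mem _ hx))) (hρ0 x)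
    rw [integral_mul_const] at this
    exact (mul_pos hpos (Real.exp_pos m)).trans_le this
  have hε1 : ∀ᶠ ε in nhdsWithin (0 : ℝ) (Ioi 0), 0 < ε ∧ ε < 1 := by
    filter_upwards [Ioo_mem_nhdsGT (zero_lt_one' ℝ)] with t ht using ht
  have t0 : Filter.Tendsto (fun ε : ℝ => ε) (nhdsWithin 0 (Ioi 0)) (nhds 0) :=
    Filter.tendsto_id.mono_left nhdsWithin_le_nhds
  have t1 : Filter.Tendsto (fun ε : ℝ => ∫ x in Icc c d, (ρ x + ε)) (nhdsWithin 0 (Ioi 0))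
      (nhds (∫ x in Icc c d, ρ x)) := by
    refine tendsto_integral_filter_of_dominated_convergence (fun x => ρ x + 1) ?_ ?_
      (hci (by fun_prop)) ?_
    · exact Filter.Eventually.of_forall fun ε =>
        (by fun_prop : Continuous fun x => ρ x + ε).aestronglyMeasurable
    · filter_upwards [hε1] with ε hε
      refine Filter.Eventually.of_forall fun x => ?_
      rw [Real.norm_of_nonneg (by linarith [hρ0 x])]; linarith
    · refine Filter.Eventually.of_forall fun x => ?_
      simpa using t0.const_add (ρ x)
  have t2 : Filter.Tendsto (fun ε : ℝ => ∫ x in Icc c d, max (ρ x * Real.exp (φ x)) ε)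
      (nhdsWithin 0 (Ioi 0)) (nhds (∫ x in Icc c d, ρ x * Real.exp (φ x))) := by
    have hnn : ∀ x, 0 ≤ ρ x * Real.exp (φ x) := fun x => mul_nonneg (hρ0 x) (Real.exp_pos _).le
    refine tendsto_integral_filter_of_dominated_convergence
      (fun x => ρ x * Real.exp (φ x) + 1) ?_ ?_ (hci (by fun_prop)) ?_
    · exact Filter.Eventually.of_forall fun ε =>
        (by fun_prop : Continuous fun x => max (ρ x * Real.exp (φ x)) ε).aestronglyMeasurable
    · filter_upwards [hε1] with ε hε
      refine Filter.Eventually.of_forall fun x => ?_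
      rw [Real.norm_of_nonneg ((hnn x).trans (le_max_left _ _))]
      exact max_le (by linarith) (by linarith [hnn x])
    · refine Filter.Eventually.of_forall fun x => ?_
      have := (tendsto_const_nhds (x := ρ x * Real.exp (φ x))).max t0
      rwa [max_eq_left (hnn x)] at this
  have t3 : Filter.Tendsto (fun ε : ℝ => ∫ x in Icc c d, k₂ ε x) (nhdsWithin 0 (Ioi 0))
      (nhds (∫ x in Icc c d, ρ x * h x)) := by
    refine tendsto_integral_filter_of_dominated_convergence
      (fun x => |ρ x * h x| + (L + |ρ x * Real.log (ρ x)|)) ?_ ?_ (hci (by fun_prop)) ?_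
    · exact Filter.Eventually.of_forall fun ε => (hk₂i ε).aestronglyMeasurable
    · filter_upwards [hε1] with ε hε
      refine Filter.Eventually.of_forall fun x => ?_
      by_cases hx0 : 0 < ρ x
      · have hk₂x : k₂ ε x
            = max (ρ x * h x) (L + (ρ x * Real.log ε - ρ x * Real.log (ρ x))) :=
          indicator_of_mem (show x ∈ {x | 0 < ρ x} from hx0) _
        have hlogε : ρ x * Real.log ε ≤ 0 :=
          mul_nonpos_of_nonneg_of_nonpos (hρ0 x) (Real.log_nonpos hε.1.le hε.2.le)
        rw [hk₂x, Real.norm_eq_abs, abs_le]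
        have h1 := neg_abs_le (ρ x * h x)
        have h2 := neg_abs_le (ρ x * Real.log (ρ x))
        have h3 := abs_nonneg (ρ x * Real.log (ρ x))
        have h4 := abs_nonneg (ρ x * h x)
        refine ⟨le_max_of_le_left (by linarith), max_le ?_ (by linarith)⟩
        linarith [le_abs_self (ρ x * h x)]
      · have hk₂x : k₂ ε x = 0 := indicator_of_notMem (show x ∉ {x | 0 < ρ x} from hx0) _
        rw [hk₂x, norm_zero]; positivity
    · refine Filter.Eventually.of_forall fun x => ?_
      by_cases hx0 : 0 < ρ x
      · refine tendsto_const_nhds.congr' ?_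
        have hlog : Filter.Tendsto (fun ε : ℝ =>
            L + (ρ x * Real.log ε - ρ x * Real.log (ρ x))) (nhdsWithin 0 (Ioi 0))
            Filter.atBot :=
          Filter.tendsto_atBot_add_const_left _ _ (Filter.tendsto_atBot_add_const_right _ _
            (Real.tendsto_log_nhdsGT_zero.const_mul_atBot hx0))
        filter_upwards [hlog.eventually_le_atBot (ρ x * h x)] with ε hε
        have hk₂x : k₂ ε x
            = max (ρ x * h x) (L + (ρ x * Real.log ε - ρ x * Real.log (ρ x))) :=
          indicator_of_mem (show x ∈ {x | 0 < ρ x} from hx0) _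
        rw [hk₂x, max_eq_left hε]
      · have hx0' : ρ x = 0 := le_antisymm (not_lt.1 hx0) (hρ0 x)
        rw [hx0', zero_mul]
        refine tendsto_const_nhds.congr fun ε => ?_
        exact (indicator_of_notMem (show x ∉ {x | 0 < ρ x} from hx0) _).symm
  have t4 : Filter.Tendsto (fun ε : ℝ => ∫ x in Icc c d,
      (ε * (Real.log B' - Real.log ε) + k₂ ε x)) (nhdsWithin 0 (Ioi 0))
      (nhds (∫ x in Icc c d, ρ x * h x)) := by
    have e : ∀ ε : ℝ, ∫ x in Icc c d, (ε * (Real.log B' - Real.log ε) + k₂ ε x)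
        = volume.real (Icc c d) * (ε * Real.log B' - ε * Real.log ε)
          + ∫ x in Icc c d, k₂ ε x := by
      intro ε
      rw [integral_add (hci continuous_const) (hk₂i ε), setIntegral_const, smul_eq_mul, mul_sub]
    simp_rw [e]
    have h1 : Filter.Tendsto (fun ε : ℝ => ε * Real.log ε) (nhdsWithin 0 (Ioi 0)) (nhds 0) := by
      have := (Real.continuous_mul_log.tendsto 0).mono_left
        (nhdsWithin_le_nhds (s := Ioi (0 : ℝ)))
      simpa using this
    have := ((((t0.mul_const (Real.log B')).sub h1).const_mul (volume.real (Icc c d))).add t3)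
    simpa using this
  refine le_of_tendsto_of_tendsto (t1.mul ((t2.log hIpos.ne').sub (t1.log hpos.ne'))) t4 ?_
  filter_upwards [hε1] with ε hε using main ε hε.1 hε.2

/-- The version of `logConcave_transport_of_lipschitzWith` for functions on the box only. -/
theorem logConcave_transport_Icc {n : ℕ} {c d : Fin n → ℝ} {ℓ R : ℝ} {K : NNReal}
    {ρ φ h : (Fin n → ℝ) → ℝ} (hcd : ∀ i, c i < d i) (hℓ : ∀ i, d i - c i ≤ ℓ) (hR : 1 ≤ R)
    (hρ : LipschitzOnWith K ρ (Icc c d)) (hρ0 : ∀ x ∈ Icc c d, 0 ≤ ρ x)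
    (hlc : CoordLogConcave (Icc c d) ρ)
    (hcx : CoordConvexUpTo R (fun i => Icc (c i) (d i)) ρ) (hφ : ContinuousOn φ (Icc c d))
    (hh : ContinuousOn h (Icc c d))
    (hφh : ∀ x ∈ Icc c d, ∀ y ∈ Icc c d,
      φ y ≤ h x + 1 / (32 * R * ℓ ^ 2) * ∑ i, (y i - x i) ^ 2)
    (hpos : 0 < ∫ x in Icc c d, ρ x) :
    (∫ x in Icc c d, ρ x) * (Real.log (∫ x in Icc c d, ρ x * Real.exp (φ x))
      - Real.log (∫ x in Icc c d, ρ x)) ≤ ∫ x in Icc c d, ρ x * h x := by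
  -- all functions are extended by composition with the projection onto the box
  set π : (Fin n → ℝ) → Fin n → ℝ := fun x i => max (c i) (min (d i) (x i)) with hπ
  have hπD : ∀ x, π x ∈ Icc c d := fun x =>
    ⟨fun i => le_max_left _ _, fun i => max_le (hcd i).le (min_le_left _ _)⟩
  have hπid : ∀ x ∈ Icc c d, π x = x := fun x hx => by
    funext i
    simp only [hπ]
    rw [min_eq_right (hx.2 i), max_eq_right (hx.1 i)]
  have hπlip : LipschitzWith 1 π := LipschitzWith.of_dist_le_mul fun x y => by
    rw [NNReal.coe_one, one_mul]
    refine (dist_pi_le_iff dist_nonneg).2 fun i => ?_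
    have h1 : LipschitzWith 1 fun u : ℝ => max (c i) (min (d i) u) :=
      (LipschitzWith.id.const_min (d i)).const_max (c i)
    have := h1.dist_le_mul (x i) (y i)
    rw [NNReal.coe_one, one_mul] at this
    exact this.trans (dist_le_pi_dist x y i)
  have hπc := hπlip.continuous
  have hcomp : ∀ F : (Fin n → ℝ) → ℝ, ContinuousOn F (Icc c d) → Continuous (F ∘ π) :=
    fun F hF => hF.comp_continuous hπc hπD
  have hint : ∀ F F' : (Fin n → ℝ) → ℝ, (∀ x ∈ Icc c d, F x = F' x) →
      ∫ x in Icc c d, F x = ∫ x in Icc c d, F' x := fun F F' hF =>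
    setIntegral_congr_fun measurableSet_Icc hF
  have e1 := hint ρ (ρ ∘ π) fun x hx => by simp [hπid x hx]
  have e2 := hint (fun x => ρ x * Real.exp (φ x)) (fun x => (ρ ∘ π) x * Real.exp ((φ ∘ π) x))
    fun x hx => by simp [hπid x hx]
  have e3 := hint (fun x => ρ x * h x) (fun x => (ρ ∘ π) x * (h ∘ π) x)
    fun x hx => by simp [hπid x hx]
  rw [e1] at hpos
  rw [e1, e2, e3]
  have hupd : ∀ x ∈ Set.pi univ fun i => Icc (c i) (d i), ∀ i, ∀ s ∈ Icc (c i) (d i),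
      Function.update x i s ∈ Icc c d := by
    intro x hx i s hs
    constructor <;> intro j <;> rcases eq_or_ne j i with rfl | hj
    · simpa using hs.1
    · simpa [hj] using (hx j (mem_univ j)).1
    · simpa using hs.2
    · simpa [hj] using (hx j (mem_univ j)).2
  refine logConcave_transport_of_lipschitzWith (K := K * 1) hcd hℓ hR ?_ (fun x => hρ0 _ (hπD x))
    ?_ ?_ (hcomp φ hφ) (hcomp h hh) ?_ hpos
  · rw [← lipschitzOnWith_univ]
    exact hρ.comp hπlip.lipschitzOnWith fun x _ => hπD x
  · intro x hx y hy r hr0 hr1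
    have hxy : r • x + (1 - r) • y ∈ Icc c d :=
      (convex_Icc c d) hx hy hr0.le (by linarith) (by ring)
    simp only [Function.comp, hπid x hx, hπid y hy, hπid _ hxy]
    exact hlc x hx y hy r hr0 hr1
  · intro x hx i s hs t ht r hr0 hr1
    have hst : r * s + (1 - r) * t ∈ Icc (c i) (d i) :=
      (convex_Icc _ _) hs ht hr0.le (by linarith : (0 : ℝ) ≤ 1 - r) (by ring)
    simp only [Function.comp, hπid _ (hupd x hx i s hs), hπid _ (hupd x hx i t ht),
      hπid _ (hupd x hx i _ hst)]
    exact hcx x hx i s hs t ht r hr0 hr1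
  · intro x hx y hy
    simp only [Function.comp, hπid x hx, hπid y hy]
    exact hφh x hx y hy

/-! ### Sub-Gaussian concentration on an open cube -/

/-- The open cube `∏ (aᵢ, aᵢ + ℓ)` as an increasing union of closed cubes. -/
lemma iUnion_Icc_eq_pi_Ioo {n : ℕ} (a : Fin n → ℝ) {ℓ : ℝ} (hℓ : 0 < ℓ) :
    ∃ δ : ℕ → ℝ, (∀ j, 0 < δ j ∧ 2 * δ j < ℓ) ∧
      Monotone (fun j => Icc (fun i => a i + δ j) fun i => a i + ℓ - δ j) ∧
      (⋃ j, Icc (fun i => a i + δ j) fun i => a i + ℓ - δ j)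
        = Set.pi univ fun i => Ioo (a i) (a i + ℓ) := by
  have hpos : ∀ j : ℕ, (0 : ℝ) < j + 3 := fun j => by positivity
  have hanti : Antitone fun j : ℕ => ℓ / (j + 3) := fun j k hjk =>
    div_le_div_of_nonneg_left hℓ.le (hpos j) (by gcongr)
  refine ⟨fun j => ℓ / (j + 3), fun j => ⟨div_pos hℓ (hpos j), ?_⟩, fun j k hjk => ?_, ?_⟩
  · rw [← mul_div_assoc, div_lt_iff₀ (hpos j)]
    have : (0 : ℝ) ≤ j := Nat.cast_nonneg j
    nlinarith
  · have := hanti hjk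
    simp only at this
    exact Icc_subset_Icc (fun i => by simpa using this) (fun i => by simp only; linarith)
  · ext x
    simp only [mem_iUnion, mem_Icc, Pi.le_def, mem_univ_pi, mem_Ioo]
    constructor
    · rintro ⟨j, h1, h2⟩ i
      have := div_pos hℓ (hpos j)
      exact ⟨by linarith [h1 i], by linarith [h2 i]⟩
    · intro hx
      have hlim : Filter.Tendsto (fun j : ℕ => ℓ / ((j : ℝ) + 3)) Filter.atTop (nhds 0) :=
        Filter.Tendsto.div_atTop tendsto_const_nhds
          (Filter.tendsto_atTop_add_const_right _ _ tendsto_natCast_atTop_atTop)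
      have hev : ∀ᶠ j : ℕ in Filter.atTop, ∀ i,
          ℓ / ((j : ℝ) + 3) < x i - a i ∧ ℓ / ((j : ℝ) + 3) < a i + ℓ - x i := by
        rw [Filter.eventually_all]
        intro i
        exact (hlim.eventually_lt_const (by linarith [(hx i).1])).and
          (hlim.eventually_lt_const (by linarith [(hx i).2]))
      obtain ⟨j, hj⟩ := hev.exists
      exact ⟨j, fun i => by linarith [(hj i).1], fun i => by linarith [(hj i).2]⟩

lemma CoordConvexUpTo.mono {n : ℕ} {R : ℝ} {I J : Fin n → Set ℝ} {ρ : (Fin n → ℝ) → ℝ}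
    (h : CoordConvexUpTo R J ρ) (hIJ : ∀ i, I i ⊆ J i) : CoordConvexUpTo R I ρ :=
  fun x hx i s hs t ht => h x (fun j hj => hIJ j (hx j hj)) i s (hIJ i hs) t (hIJ i ht)

/-- A log-concave function that is convex up to a factor along the axes is continuous on the open
cube, also at the boundary of its support. -/
lemma continuousOn_of_logConcave_of_convexUpTo {n : ℕ} {a : Fin n → ℝ} {ℓ R : ℝ}
    {ρ : (Fin n → ℝ) → ℝ} (hR : 1 ≤ R)
    (hρ0 : ∀ x ∈ Set.pi univ fun i => Ioo (a i) (a i + ℓ), 0 ≤ ρ x)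
    (hlc : CoordLogConcave (Set.pi univ fun i => Ioo (a i) (a i + ℓ)) ρ)
    (hcx : CoordConvexUpTo R (fun i => Ioo (a i) (a i + ℓ)) ρ) :
    ContinuousOn ρ (Set.pi univ fun i => Ioo (a i) (a i + ℓ)) := by
  intro x hx
  have hev : ∀ᶠ δ : ℝ in nhdsWithin 0 (Ioi 0), ∀ i,
      δ < x i - a i ∧ δ < a i + ℓ - x i := by
    rw [Filter.eventually_all]
    intro i
    have t0 : Filter.Tendsto (fun ε : ℝ => ε) (nhdsWithin 0 (Ioi 0)) (nhds 0) :=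
      Filter.tendsto_id.mono_left nhdsWithin_le_nhds
    have := hx i (mem_univ i)
    exact (t0.eventually_lt_const (by linarith [this.1])).and
      (t0.eventually_lt_const (by linarith [this.2]))
  obtain ⟨δ, hδ, hδ0⟩ := (hev.and self_mem_nhdsWithin).exists
  obtain ⟨K, hK⟩ := exists_lipschitzOnWith hδ0 hR hρ0 hlc hcx
  refine (hK.continuousOn.continuousAt ?_).continuousWithinAt
  rw [← pi_univ_Icc]
  exact set_pi_mem_nhds finite_univ fun i _ =>
    Icc_mem_nhds (by linarith [(hδ i).1]) (by linarith [(hδ i).2])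

/-- The transport inequality for a log-concave probability density on the open cube that is convex
up to the factor `R` along the axes. -/
theorem logConcave_transport_Ioo {n : ℕ} {a : Fin n → ℝ} {ℓ R M : ℝ}
    {ρ φ h : (Fin n → ℝ) → ℝ} (hℓ : 0 < ℓ) (hR : 1 ≤ R)
    (hρ0 : ∀ x ∈ Set.pi univ fun i => Ioo (a i) (a i + ℓ), 0 ≤ ρ x)
    (hlc : CoordLogConcave (Set.pi univ fun i => Ioo (a i) (a i + ℓ)) ρ)
    (hcx : CoordConvexUpTo R (fun i => Ioo (a i) (a i + ℓ)) ρ)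
    (hρi : IntegrableOn ρ (Set.pi univ fun i => Ioo (a i) (a i + ℓ)))
    (hρ1 : ∫ x in Set.pi univ fun i => Ioo (a i) (a i + ℓ), ρ x = 1)
    (hφ : ContinuousOn φ (Set.pi univ fun i => Ioo (a i) (a i + ℓ)))
    (hh : ContinuousOn h (Set.pi univ fun i => Ioo (a i) (a i + ℓ)))
    (hφM : ∀ x ∈ Set.pi univ fun i => Ioo (a i) (a i + ℓ), |φ x| ≤ M)
    (hhM : ∀ x ∈ Set.pi univ fun i => Ioo (a i) (a i + ℓ), |h x| ≤ M)
    (hφh : ∀ x ∈ Set.pi univ fun i => Ioo (a i) (a i + ℓ),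
      ∀ y ∈ Set.pi univ fun i => Ioo (a i) (a i + ℓ),
      φ y ≤ h x + 1 / (32 * R * ℓ ^ 2) * ∑ i, (y i - x i) ^ 2) :
    ∫ x in Set.pi univ fun i => Ioo (a i) (a i + ℓ), ρ x * Real.exp (φ x)
      ≤ Real.exp (∫ x in Set.pi univ fun i => Ioo (a i) (a i + ℓ), ρ x * h x) := by
  obtain ⟨δ, hδ, hmono, hU⟩ := iUnion_Icc_eq_pi_Ioo a hℓ
  set U := Set.pi univ fun i => Ioo (a i) (a i + ℓ) with hUdef
  have hUm : MeasurableSet U := MeasurableSet.univ_pi fun i => measurableSet_Ioo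
  set D : ℕ → Set (Fin n → ℝ) := fun j =>
    Icc (fun i => a i + δ j) fun i => a i + ℓ - δ j with hD
  have hDU : ∀ j, D j ⊆ U := fun j => hU ▸ subset_iUnion D j
  have hDI : ∀ j i, Icc (a i + δ j) (a i + ℓ - δ j) ⊆ Ioo (a i) (a i + ℓ) := fun j i x hx =>
    ⟨by linarith [hx.1, (hδ j).1], by linarith [hx.2, (hδ j).1]⟩
  have hexpM : ∀ x ∈ U, ‖Real.exp (φ x)‖ ≤ Real.exp M := fun x hx => by
    rw [Real.norm_of_nonneg (Real.exp_pos _).le]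
    exact Real.exp_le_exp.2 ((le_abs_self _).trans (hφM x hx))
  have hφi : IntegrableOn (fun x => ρ x * Real.exp (φ x)) U :=
    Integrable.mul_bdd (c := Real.exp M) hρi
      ((Real.continuous_exp.comp_continuousOn hφ).aestronglyMeasurable hUm)
      (by filter_upwards [ae_restrict_mem hUm] with x hx using hexpM x hx)
  have hhi : IntegrableOn (fun x => ρ x * h x) U :=
    Integrable.mul_bdd (c := M) hρi (hh.aestronglyMeasurable hUm)
      (by filter_upwards [ae_restrict_mem hUm] with x hx using hhM x hx)
  have hlim : ∀ F : (Fin n → ℝ) → ℝ, IntegrableOn F U →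
      Filter.Tendsto (fun j => ∫ x in D j, F x) Filter.atTop (nhds (∫ x in U, F x)) := by
    intro F hF
    have := tendsto_setIntegral_of_monotone (μ := volume) (f := F) (s := D)
      (fun j => measurableSet_Icc) hmono (by rwa [hU])
    rwa [hU] at this
  have t1 := hlim ρ hρi
  have t2 := hlim _ hφi
  have t3 := hlim _ hhi
  rw [hρ1] at t1
  have hIpos : 0 < ∫ x in U, ρ x * Real.exp (φ x) := by
    have : ∫ x in U, ρ x * Real.exp (-M) ≤ ∫ x in U, ρ x * Real.exp (φ x) :=
      setIntegral_mono_on (hρi.mul_const _) hφi hUm fun x hx =>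
        mul_le_mul_of_nonneg_left (Real.exp_le_exp.2 (abs_le.1 (hφM x hx)).1) (hρ0 x hx)
    rw [integral_mul_const, hρ1, one_mul] at this
    exact (Real.exp_pos _).trans_le this
  have hfin : ∀ᶠ j in Filter.atTop, (∫ x in D j, ρ x)
      * (Real.log (∫ x in D j, ρ x * Real.exp (φ x)) - Real.log (∫ x in D j, ρ x))
      ≤ ∫ x in D j, ρ x * h x := by
    filter_upwards [t1.eventually_const_lt zero_lt_one] with j hj
    obtain ⟨K, hK⟩ := exists_lipschitzOnWith (hδ j).1 hR hρ0 hlc hcx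
    exact logConcave_transport_Icc (fun i => by linarith [(hδ j).2])
      (fun i => by linarith [(hδ j).1]) hR hK (fun x hx => hρ0 x (hDU j hx))
      (fun x hx y hy => hlc x (hDU j hx) y (hDU j hy)) (hcx.mono (hDI j))
      (hφ.mono (hDU j)) (hh.mono (hDU j))
      (fun x hx y hy => hφh x (hDU j hx) y (hDU j hy)) hj
  have := le_of_tendsto_of_tendsto
    (t1.mul ((t2.log hIpos.ne').sub (t1.log one_ne_zero))) t3 hfin
  rw [one_mul, Real.log_one, sub_zero] at this
  exact (Real.log_le_iff_le_exp hIpos).1 this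

/-- Lipschitz functions are sub-Gaussian with respect to a log-concave probability measure on the
open cube whose density is convex up to the factor `R` along the axes. This is the transport
inequality applied to `φ = s f` and `h = s f + 8 R ℓ² s²`. -/
theorem hasSubgaussianMGF_of_logConcave {n : ℕ} {a : Fin n → ℝ} {ℓ R : ℝ}
    {ρ f : (Fin n → ℝ) → ℝ} {ν : Measure (Fin n → ℝ)} [IsProbabilityMeasure ν] (hℓ : 0 < ℓ)
    (hR : 1 ≤ R) (hρ0 : ∀ x ∈ Set.pi univ fun i => Ioo (a i) (a i + ℓ), 0 ≤ ρ x)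
    (hlc : CoordLogConcave (Set.pi univ fun i => Ioo (a i) (a i + ℓ)) ρ)
    (hcx : CoordConvexUpTo R (fun i => Ioo (a i) (a i + ℓ)) ρ)
    (hν : ν = (volume.restrict (Set.pi univ fun i => Ioo (a i) (a i + ℓ))).withDensity
      fun x => ENNReal.ofReal (ρ x))
    (hf : ∀ x ∈ Set.pi univ fun i => Ioo (a i) (a i + ℓ),
      ∀ y ∈ Set.pi univ fun i => Ioo (a i) (a i + ℓ),
      |f x - f y| ≤ Real.sqrt (∑ i, (x i - y i) ^ 2)) :
    Integrable f ν ∧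
      HasSubgaussianMGF (fun x => f x - ∫ y, f y ∂ν) (16 * R * ℓ ^ 2).toNNReal ν := by
  set U := Set.pi univ fun i => Ioo (a i) (a i + ℓ) with hU
  have hUm : MeasurableSet U := MeasurableSet.univ_pi fun i => measurableSet_Ioo
  have hρc := continuousOn_of_logConcave_of_convexUpTo hR hρ0 hlc hcx
  have hρae : AEMeasurable (fun x => ENNReal.ofReal (ρ x)) (volume.restrict U) :=
    (hρc.aestronglyMeasurable hUm).aemeasurable.ennreal_ofReal
  have hνint : ∀ F : (Fin n → ℝ) → ℝ, ∫ x, F x ∂ν = ∫ x in U, ρ x * F x := by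
    intro F
    rw [hν, integral_withDensity_eq_integral_toReal_smul₀ hρae
      (Filter.Eventually.of_forall fun _ => ENNReal.ofReal_lt_top)]
    refine setIntegral_congr_fun hUm fun x hx => ?_
    rw [ENNReal.toReal_ofReal (hρ0 x hx), smul_eq_mul]
  have hνU : ∀ᵐ x ∂ν, x ∈ U := by
    rw [hν]
    exact (withDensity_absolutelyContinuous _ _).ae_le (ae_restrict_mem hUm)
  have hρi : IntegrableOn ρ U := by
    refine ⟨hρc.aestronglyMeasurable hUm, ?_⟩
    rw [hasFiniteIntegral_iff_norm]
    have h1 : ∫⁻ x in U, ENNReal.ofReal ‖ρ x‖ = ν univ := by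
      rw [hν, withDensity_apply _ MeasurableSet.univ, Measure.restrict_univ]
      refine setLIntegral_congr_fun hUm fun x hx => ?_
      rw [Real.norm_of_nonneg (hρ0 x hx)]
    rw [h1, measure_univ]
    exact ENNReal.one_lt_top
  have hρ1 : ∫ x in U, ρ x = 1 := by
    have := hνint fun _ => 1
    simpa using this.symm
  -- `f` is continuous and bounded on the cube
  have hfl : LipschitzOnWith (Real.sqrt n).toNNReal f U := by
    refine LipschitzOnWith.of_dist_le_mul fun x hx y hy => ?_
    rw [Real.dist_eq, Real.coe_toNNReal _ (Real.sqrt_nonneg _)]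
    refine (hf x hx y hy).trans ?_
    rw [← Real.sqrt_sq (dist_nonneg (x := x) (y := y)), ← Real.sqrt_mul (Nat.cast_nonneg n)]
    refine Real.sqrt_le_sqrt ?_
    calc ∑ i, (x i - y i) ^ 2 ≤ ∑ _i : Fin n, dist x y ^ 2 := Finset.sum_le_sum fun i _ => by
          rw [← sq_abs, ← Real.dist_eq]
          exact pow_le_pow_left₀ dist_nonneg (dist_le_pi_dist x y i) 2
      _ = n * dist x y ^ 2 := by simp
  have hfc : ContinuousOn f U := hfl.continuousOn
  obtain ⟨M, hM⟩ : ∃ M : ℝ, ∀ x ∈ U, |f x| ≤ M := by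
    have hx₀ : (fun i => a i + ℓ / 2) ∈ U := fun i _ => ⟨by linarith, by linarith⟩
    refine ⟨|f fun i => a i + ℓ / 2| + (Real.sqrt n).toNNReal * ℓ, fun x hx => ?_⟩
    have h1 := hfl.dist_le_mul x hx _ hx₀
    have h2 : dist x (fun i => a i + ℓ / 2) ≤ ℓ := by
      refine (dist_pi_le_iff hℓ.le).2 fun i => ?_
      have := hx i (mem_univ i)
      rw [Real.dist_eq, abs_le]
      constructor <;> linarith [this.1, this.2]
    have h3 := mul_le_mul_of_nonneg_left h2 (Real.sqrt n).toNNReal.2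
    rw [Real.dist_eq] at h1
    have h4 := abs_sub_abs_le_abs_sub (f x) (f fun i => a i + ℓ / 2)
    linarith [show ((Real.sqrt n).toNNReal : ℝ) * dist x (fun i => a i + ℓ / 2)
      ≤ (Real.sqrt n).toNNReal * ℓ from h3]
  have hfae : AEStronglyMeasurable f ν := by
    rw [hν]
    exact (hfc.aestronglyMeasurable hUm).mono_ac (withDensity_absolutelyContinuous _ _)
  have hfi : Integrable f ν := Integrable.of_bound hfae M (hνU.mono fun x hx => hM x hx)
  set E := ∫ y, f y ∂ν with hE
  refine ⟨hfi, fun s => ?_, fun s => ?_⟩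
  · refine Integrable.of_bound (Real.continuous_exp.comp_aestronglyMeasurable
      ((hfae.sub aestronglyMeasurable_const).const_mul s)) (Real.exp (|s| * (M + |E|))) ?_
    refine hνU.mono fun x hx => ?_
    rw [Real.norm_of_nonneg (Real.exp_pos _).le]
    refine Real.exp_le_exp.2 ((le_abs_self _).trans ?_)
    rw [abs_mul]
    exact mul_le_mul_of_nonneg_left ((abs_sub _ _).trans (by linarith [hM x hx])) (abs_nonneg s)
  · have hkey := logConcave_transport_Ioo (φ := fun x => s * f x)
      (h := fun x => s * f x + 8 * R * ℓ ^ 2 * s ^ 2) (M := |s| * M + 8 * R * ℓ ^ 2 * s ^ 2)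
      hℓ hR hρ0 hlc hcx hρi hρ1 (hfc.const_mul s |>.congr fun _ _ => rfl)
      ((hfc.const_mul s).add continuousOn_const |>.congr fun _ _ => rfl)
      (fun x hx => by
        rw [abs_mul]
        have := mul_le_mul_of_nonneg_left (hM x hx) (abs_nonneg s)
        have : 0 ≤ 8 * R * ℓ ^ 2 * s ^ 2 := by positivity
        linarith)
      (fun x hx => by
        refine (abs_add_le _ _).trans ?_
        rw [abs_mul, abs_of_nonneg (by positivity : 0 ≤ 8 * R * ℓ ^ 2 * s ^ 2)]
        have := mul_le_mul_of_nonneg_left (hM x hx) (abs_nonneg s)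
        linarith)
      (fun x hx y hy => by
        -- Young's inequality for `|s| * √S`
        set S := ∑ i, (y i - x i) ^ 2 with hS
        have hS0 : 0 ≤ S := Finset.sum_nonneg fun i _ => sq_nonneg _
        have h1 : s * f y - s * f x ≤ |s| * Real.sqrt S := by
          rw [← mul_sub]
          refine (le_abs_self _).trans ?_
          rw [abs_mul]
          exact mul_le_mul_of_nonneg_left (hf y hy x hx) (abs_nonneg s)
        have h2 : |s| * Real.sqrt S ≤ 1 / (32 * R * ℓ ^ 2) * S + 8 * R * ℓ ^ 2 * s ^ 2 := by
          have hc : 0 < 32 * R * ℓ ^ 2 := by positivity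
          have h3 : 1 / (32 * R * ℓ ^ 2) * S + 8 * R * ℓ ^ 2 * s ^ 2 - |s| * Real.sqrt S
              = (Real.sqrt S - 16 * R * ℓ ^ 2 * |s|) ^ 2 / (32 * R * ℓ ^ 2) := by
            have h4 := Real.sq_sqrt hS0
            rw [sub_sq, h4, mul_pow _ |s|, sq_abs]
            field_simp
            ring
          have : 0 ≤ (Real.sqrt S - 16 * R * ℓ ^ 2 * |s|) ^ 2 / (32 * R * ℓ ^ 2) := by positivity
          linarith
        linarith)
    rw [← hνint fun x => Real.exp (s * f x), ← hνint fun x => s * f x + 8 * R * ℓ ^ 2 * s ^ 2,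
      integral_add (hfi.const_mul s) (integrable_const _), integral_const_mul] at hkey
    have e1 : mgf (fun x => f x - E) ν s
        = Real.exp (-(s * E)) * ∫ x, Real.exp (s * f x) ∂ν := by
      rw [mgf, ← integral_const_mul]
      refine integral_congr_ae (Filter.Eventually.of_forall fun x => ?_)
      simp only
      rw [← Real.exp_add]
      congr 1; ring
    rw [e1]
    refine (mul_le_mul_of_nonneg_left hkey (Real.exp_pos _).le).trans_eq ?_
    rw [← Real.exp_add, Real.coe_toNNReal _ (by positivity)]
    congr 1
    simp
    ring

/-! ### Variance of sub-Gaussian variables -/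

lemma two_add_sq_div_two_le_exp_add_exp_neg (u : ℝ) :
    2 + u ^ 2 / 2 ≤ Real.exp u + Real.exp (-u) := by
  have h1 := Real.quadratic_le_exp_of_nonneg (abs_nonneg u)
  have h2 := Real.add_one_le_exp (-|u|)
  rw [sq_abs] at h1
  rcases abs_cases u with ⟨h, _⟩ | ⟨h, _⟩ <;> rw [h] at h1 h2
  · linarith
  · rw [neg_neg] at h2; linarith

lemma HasSubgaussianMGF.integral_sq_le {Ω : Type*} [MeasurableSpace Ω] {μ : Measure Ω}
    [IsProbabilityMeasure μ] {Y : Ω → ℝ} {c : NNReal} (hc : 0 < c)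
    (h : HasSubgaussianMGF Y c μ) : ∫ x, Y x ^ 2 ∂μ ≤ 4 * c := by
  have hc' : (0 : ℝ) < c := hc
  have hs := Real.sq_sqrt (by positivity : (0 : ℝ) ≤ 2 / c)
  -- this `s` makes the exponent `c s² / 2` of the moment bound equal to one
  set s := Real.sqrt (2 / c) with hsdef
  have h1 := h.mgf_le s
  have h2 := h.mgf_le (-s)
  rw [neg_sq] at h2
  have e1 : (c : ℝ) * s ^ 2 / 2 = 1 := by rw [hs]; field_simp
  rw [e1] at h1 h2
  have hsq : Integrable (fun x => Y x ^ 2) μ := (h.memLp 2).integrable_sq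
  have hmono : ∫ x, (2 + s ^ 2 / 2 * Y x ^ 2) ∂μ
      ≤ ∫ x, (Real.exp (s * Y x) + Real.exp (-s * Y x)) ∂μ := by
    refine integral_mono ((integrable_const _).add (hsq.const_mul _))
      ((h.integrable_exp_mul s).add (h.integrable_exp_mul (-s))) fun x => ?_
    have := two_add_sq_div_two_le_exp_add_exp_neg (s * Y x)
    rw [mul_pow, ← neg_mul] at this
    simp only
    linarith
  rw [integral_add (integrable_const _) (hsq.const_mul _), integral_const_mul,
    integral_add (h.integrable_exp_mul s) (h.integrable_exp_mul (-s))] at hmono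
  simp only [integral_const, probReal_univ, one_smul] at hmono
  rw [mgf] at h1 h2
  have he := Real.exp_one_lt_d9
  rw [hs] at hmono
  have h3 : 2 / (c : ℝ) / 2 * ∫ x, Y x ^ 2 ∂μ ≤ 4 := by linarith
  have e2 : 2 / (c : ℝ) / 2 = (c : ℝ)⁻¹ := by field_simp
  rwa [e2, inv_mul_le_iff₀ hc', mul_comm] at h3

/-! ### The two classes of densities -/

open WithLp in
lemma toLp_update_add_smul {n : ℕ} (x : Fin n → ℝ) (i : Fin n) (u t : ℝ) :
    toLp 2 (Function.update x i u) + t • EuclideanSpace.single i (1 : ℝ)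
      = toLp 2 (Function.update x i (u + t)) := by
  ext j
  rcases eq_or_ne j i with rfl | h
  · simp
  · simp [h]

open WithLp in
lemma toLp_mem_interior {n : ℕ} {ℓ : ℝ} {Q : Set (EuclideanSpace ℝ (Fin n))}
    {a : EuclideanSpace ℝ (Fin n)}
    (hQ : Q = {x | ∀ i, x i ∈ Ioo (a i) (a i + ℓ)} ∨ Q = {x | ∀ i, x i ∈ Icc (a i) (a i + ℓ)})
    {x : Fin n → ℝ} (hx : x ∈ Set.pi univ fun i => Ioo (a i) (a i + ℓ)) :
    toLp 2 x ∈ interior Q := by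
  have hopen : IsOpen {x : EuclideanSpace ℝ (Fin n) | ∀ i, x i ∈ Ioo (a i) (a i + ℓ)} := by
    have : {x : EuclideanSpace ℝ (Fin n) | ∀ i, x i ∈ Ioo (a i) (a i + ℓ)}
        = ofLp ⁻¹' (Set.pi univ fun i => Ioo (a i) (a i + ℓ)) := by ext; simp
    rw [this]
    exact (isOpen_set_pi finite_univ fun i _ => isOpen_Ioo).preimage
      (PiLp.continuous_ofLp 2 _)
  have hsub : {x : EuclideanSpace ℝ (Fin n) | ∀ i, x i ∈ Ioo (a i) (a i + ℓ)} ⊆ Q := by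
    rcases hQ with rfl | rfl
    · exact Subset.rfl
    · exact fun x hx i => Ioo_subset_Icc_self (hx i)
  exact interior_maximal hsub hopen fun i => hx i (mem_univ i)

/-- A function on an interval of length `ℓ` whose second derivative is at most `M` is concave up to
the additive constant `M ℓ² / 8`. -/
lemma le_add_of_second_deriv_le {a ℓ M : ℝ} {q q' q'' : ℝ → ℝ} (hM : 0 ≤ M)
    (hq : ∀ u ∈ Ioo a (a + ℓ), HasDerivAt q (q' u) u)
    (hq' : ∀ u ∈ Ioo a (a + ℓ), HasDerivAt q' (q'' u) u)
    (hq'' : ∀ u ∈ Ioo a (a + ℓ), q'' u ≤ M) {s t r : ℝ} (hs : s ∈ Ioo a (a + ℓ))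
    (ht : t ∈ Ioo a (a + ℓ)) (hr0 : 0 < r) (hr1 : r < 1) :
    r * q s + (1 - r) * q t ≤ q (r * s + (1 - r) * t) + M * ℓ ^ 2 / 8 := by
  have hconv : ConvexOn ℝ (Ioo a (a + ℓ)) fun u => M / 2 * u ^ 2 - q u := by
    refine convexOn_of_hasDerivWithinAt2_nonneg (convex_Ioo _ _)
      (f' := fun u => M * u - q' u) (f'' := fun u => M - q'' u) ?_ ?_ ?_ ?_
    · intro u hu
      have := (hq u hu).continuousAt
      exact ContinuousAt.continuousWithinAt (by fun_prop)
    · intro u hu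
      rw [interior_Ioo] at hu
      have h1 := ((hasDerivAt_pow 2 u).const_mul (M / 2)).sub (hq u hu)
      refine (h1.congr_deriv ?_).hasDerivWithinAt
      simp; ring
    · intro u hu
      rw [interior_Ioo] at hu
      have h1 := ((hasDerivAt_id u).const_mul M).sub (hq' u hu)
      refine (h1.congr_deriv ?_).hasDerivWithinAt
      simp
    · intro u hu
      rw [interior_Ioo] at hu
      linarith [hq'' u hu]
  have h := hconv.2 hs ht hr0.le (by linarith : 0 ≤ 1 - r) (by ring)
  simp only [smul_eq_mul] at h
  have h1 : (s - t) ^ 2 ≤ ℓ ^ 2 := by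
    refine sq_le_sq' ?_ ?_ <;> linarith [hs.1, hs.2, ht.1, ht.2]
  have h2 : r * (1 - r) ≤ 1 / 4 := by nlinarith [sq_nonneg (r - 1 / 2)]
  have h3 : r * (1 - r) * (s - t) ^ 2 ≤ 1 / 4 * ℓ ^ 2 :=
    mul_le_mul h2 h1 (sq_nonneg _) (by norm_num)
  have h4 := mul_le_mul_of_nonneg_left h3 (by linarith : 0 ≤ M / 2)
  have e : M / 2 * (r * (1 - r) * (s - t) ^ 2)
      = r * (M / 2 * s ^ 2) + (1 - r) * (M / 2 * t ^ 2) - M / 2 * (r * s + (1 - r) * t) ^ 2 := by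
    ring
  linarith

open WithLp in
/-- If `ψ` is convex with pure second derivatives at most `M`, then `exp (-ψ)` is log-concave and
convex up to the factor `exp (M ℓ² / 8)` along the axes. -/
lemma exp_neg_logConcave_and_convexUpTo {n : ℕ} {ℓ M : ℝ} {Q : Set (EuclideanSpace ℝ (Fin n))}
    {a : EuclideanSpace ℝ (Fin n)} {ψ : EuclideanSpace ℝ (Fin n) → ℝ} (hM : 0 ≤ M)
    (hQ : Q = {x | ∀ i, x i ∈ Ioo (a i) (a i + ℓ)} ∨ Q = {x | ∀ i, x i ∈ Icc (a i) (a i + ℓ)})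
    (hψ : ConvexOn ℝ Q ψ) (hψ'' : PureSecondDerivLE M Q ψ) :
    CoordLogConcave (Set.pi univ fun i => Ioo (a i) (a i + ℓ))
      (fun x => Real.exp (-ψ (toLp 2 x))) ∧
    CoordConvexUpTo (Real.exp (M * ℓ ^ 2 / 8)) (fun i => Ioo (a i) (a i + ℓ))
      fun x => Real.exp (-ψ (toLp 2 x)) := by
  constructor
  · intro x hx y hy r hr0 hr1
    have h := hψ.2 (interior_subset (toLp_mem_interior hQ hx))
      (interior_subset (toLp_mem_interior hQ hy)) hr0.le (by linarith : 0 ≤ 1 - r) (by ring)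
    rw [← Real.exp_mul, ← Real.exp_mul, ← Real.exp_add]
    refine Real.exp_le_exp.2 ?_
    rw [toLp_add, toLp_smul, toLp_smul]
    simp only [smul_eq_mul] at h
    linarith
  · intro x hx i s hs t ht r hr0 hr1
    have hmem : ∀ u ∈ Ioo (a i) (a i + ℓ), toLp 2 (Function.update x i u) ∈ interior Q := by
      intro u hu
      refine toLp_mem_interior hQ fun j _ => ?_
      rcases eq_or_ne j i with rfl | h
      · simpa using hu
      · simpa [h] using hx j (mem_univ j)
    have hline : ∀ (F : EuclideanSpace ℝ (Fin n) → ℝ) (u : ℝ),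
        LineDifferentiableAt ℝ F (toLp 2 (Function.update x i u)) (EuclideanSpace.single i 1) →
        HasDerivAt (fun u => F (toLp 2 (Function.update x i u)))
          (partialDeriv i F (toLp 2 (Function.update x i u))) u := by
      intro F u hF
      have h1 : HasDerivAt (fun t : ℝ => F (toLp 2 (Function.update x i u)
          + t • EuclideanSpace.single i (1 : ℝ)))
          (partialDeriv i F (toLp 2 (Function.update x i u))) (u - u) := by
        rw [sub_self]; exact hF.hasLineDerivAt
      have h2 := HasDerivAt.comp (h := fun w => w - u) (h' := 1) u h1
        ((hasDerivAt_id u).sub_const u)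
      rw [mul_one] at h2
      refine h2.congr_of_eventuallyEq (Filter.Eventually.of_forall fun w => ?_)
      simp only [Function.comp, toLp_update_add_smul, add_sub_cancel]
    have h := le_add_of_second_deriv_le hM
      (q := fun u => ψ (toLp 2 (Function.update x i u)))
      (fun u hu => hline ψ u (hψ'' _ (hmem u hu) i).1)
      (fun u hu => hline (partialDeriv i ψ) u (hψ'' _ (hmem u hu) i).2.1)
      (fun u hu => (hψ'' _ (hmem u hu) i).2.2) hs ht hr0 hr1
    have hexp := convexOn_exp.2 (mem_univ (-ψ (toLp 2 (Function.update x i s))))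
      (mem_univ (-ψ (toLp 2 (Function.update x i t)))) hr0.le (by linarith : 0 ≤ 1 - r) (by ring)
    simp only [smul_eq_mul] at hexp
    refine le_trans ?_ (mul_le_mul_of_nonneg_left hexp (Real.exp_pos _).le)
    rw [← Real.exp_add]
    refine Real.exp_le_exp.2 ?_
    linarith

open WithLp in
lemma logConcave_and_convexUpTo_of_axis {n : ℕ} {ℓ R : ℝ} {Q : Set (EuclideanSpace ℝ (Fin n))}
    {a : EuclideanSpace ℝ (Fin n)} {ρ : EuclideanSpace ℝ (Fin n) → ℝ}
    (hQ : Q = {x | ∀ i, x i ∈ Ioo (a i) (a i + ℓ)} ∨ Q = {x | ∀ i, x i ∈ Icc (a i) (a i + ℓ)})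
    (hρ : IsLogConcaveOn Q ρ) (hR : AxisConvexUpTo R Q ρ) :
    CoordLogConcave (Set.pi univ fun i => Ioo (a i) (a i + ℓ)) (fun x => ρ (toLp 2 x)) ∧
    CoordConvexUpTo R (fun i => Ioo (a i) (a i + ℓ)) fun x => ρ (toLp 2 x) := by
  constructor
  · intro x hx y hy r hr0 hr1
    have := hρ.2.2 _ (interior_subset (toLp_mem_interior hQ hx)) _
      (interior_subset (toLp_mem_interior hQ hy)) r hr0 hr1
    rwa [← toLp_smul, ← toLp_smul, ← toLp_add] at this
  · intro x hx i s hs t ht r hr0 hr1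
    have hmem : ∀ u ∈ Ioo (a i) (a i + ℓ), toLp 2 (Function.update x i u) ∈ Q := by
      intro u hu
      refine interior_subset (toLp_mem_interior hQ fun j _ => ?_)
      rcases eq_or_ne j i with rfl | h
      · simpa using hu
      · simpa [h] using hx j (mem_univ j)
    have hv : IsAxisVector (toLp 2 (Function.update x i s) - toLp 2 (Function.update x i t)) := by
      have key : ∀ j, (toLp 2 (Function.update x i s) - toLp 2 (Function.update x i t)
          : EuclideanSpace ℝ (Fin n)) j ≠ 0 → j = i := by
        intro j hj
        by_contra hne
        exact hj (by simp [hne])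
      intro j hj k hk
      rw [key j hj, key k hk]
    have := hR _ (hmem s hs) _ (hmem t ht) hv r hr0 hr1
    rwa [← toLp_smul, ← toLp_smul, ← toLp_add, update_combination] at this

open WithLp in
/-- In coordinates, the measure does not charge the boundary of the cube. -/
lemma map_ofLp_eq_withDensity {n : ℕ} {ℓ : ℝ} {Q : Set (EuclideanSpace ℝ (Fin n))}
    {a : EuclideanSpace ℝ (Fin n)} {μ : Measure (EuclideanSpace ℝ (Fin n))}
    {ρ : EuclideanSpace ℝ (Fin n) → ℝ}
    (hQ : Q = {x | ∀ i, x i ∈ Ioo (a i) (a i + ℓ)} ∨ Q = {x | ∀ i, x i ∈ Icc (a i) (a i + ℓ)})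
    (hμ : HasDensityOn μ Q ρ) :
    μ.map ofLp = (volume.restrict (Set.pi univ fun i => Ioo (a i) (a i + ℓ))).withDensity
      fun x => ENNReal.ofReal (ρ (toLp 2 x)) := by
  set e := (MeasurableEquiv.toLp 2 (Fin n → ℝ)).symm with he
  have hmp : MeasurePreserving e := EuclideanSpace.volume_preserving_symm_measurableEquiv_toLp _
  obtain ⟨V, hV, hQV⟩ : ∃ V : Set (Fin n → ℝ),
      V =ᵐ[volume] Set.pi univ (fun i => Ioo (a i) (a i + ℓ)) ∧ Q = e ⁻¹' V := by
    rcases hQ with rfl | rfl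
    · exact ⟨_, ae_eq_refl _, by ext; simp [he]⟩
    · refine ⟨Icc (fun i => a i) fun i => a i + ℓ, Measure.univ_pi_Ioo_ae_eq_Icc.symm, ?_⟩
      ext x
      simp [he, Pi.le_def, forall_and]
  rw [← Measure.restrict_congr_set hV]
  have hmpV := hmp.restrict_preimage_emb e.measurableEmbedding V
  rw [← hQV] at hmpV
  change μ.map e = _
  ext S hS
  rw [Measure.map_apply e.measurable hS, hμ, withDensity_apply _ (e.measurable hS),
    withDensity_apply _ hS,
    ← (hmpV.restrict_preimage_emb e.measurableEmbedding S).lintegral_comp_emb e.measurableEmbedding]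
  rfl

open WithLp in
/-- Lipschitz functions on the cube are integrable and sub-Gaussian. -/
theorem hasSubgaussianMGF_of_hasDensityOn {n : ℕ} {ℓ R : ℝ} {Q : Set (EuclideanSpace ℝ (Fin n))}
    {a : EuclideanSpace ℝ (Fin n)} {μ : Measure (EuclideanSpace ℝ (Fin n))}
    [IsProbabilityMeasure μ] {ρ f : EuclideanSpace ℝ (Fin n) → ℝ} (hℓ : 0 < ℓ) (hR : 1 ≤ R)
    (hQ : Q = {x | ∀ i, x i ∈ Ioo (a i) (a i + ℓ)} ∨ Q = {x | ∀ i, x i ∈ Icc (a i) (a i + ℓ)})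
    (hμ : HasDensityOn μ Q ρ) (hρ0 : ∀ x ∈ Q, 0 ≤ ρ x)
    (hlc : CoordLogConcave (Set.pi univ fun i => Ioo (a i) (a i + ℓ)) fun x => ρ (toLp 2 x))
    (hcx : CoordConvexUpTo R (fun i => Ioo (a i) (a i + ℓ)) fun x => ρ (toLp 2 x))
    (hf : LipschitzOnWith 1 f Q) :
    Integrable f μ ∧
      HasSubgaussianMGF (fun x => f x - ∫ y, f y ∂μ) (16 * R * ℓ ^ 2).toNNReal μ := by
  set e := (MeasurableEquiv.toLp 2 (Fin n → ℝ)).symm with he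
  have hmap : μ.map e = _ := map_ofLp_eq_withDensity hQ hμ
  have : IsProbabilityMeasure (μ.map e) :=
    Measure.isProbabilityMeasure_map e.measurable.aemeasurable
  have hmem : ∀ x ∈ Set.pi univ (fun i => Ioo (a i) (a i + ℓ)), toLp 2 x ∈ Q := fun x hx =>
    interior_subset (toLp_mem_interior hQ hx)
  obtain ⟨h1, h2⟩ := hasSubgaussianMGF_of_logConcave (f := fun x => f (toLp 2 x)) hℓ hR
    (fun x hx => hρ0 _ (hmem x hx)) hlc hcx hmap (fun x hx y hy => by
      have := hf.dist_le_mul _ (hmem x hx) _ (hmem y hy)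
      rw [NNReal.coe_one, one_mul, EuclideanSpace.dist_eq, Real.dist_eq] at this
      simpa [Real.dist_eq, sq_abs] using this)
  have hfe : (fun x => f (toLp 2 x)) ∘ e = f := rfl
  have hint : ∫ y, f (toLp 2 y) ∂(μ.map e) = ∫ y, f y ∂μ := by
    rw [integral_map_equiv]; rfl
  rw [hint] at h2
  refine ⟨?_, h2.of_map e.measurable.aemeasurable⟩
  rw [← hfe]
  exact (integrable_map_equiv e _).1 h1

/-! ### Concentration and covariance -/

/-- Both conclusions, for a density that is log-concave and convex up to a factor along the axes
in the open cube. -/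
theorem concentration_and_covMatrix_le {n : ℕ} {ℓ R : ℝ} {Q : Set (EuclideanSpace ℝ (Fin n))}
    {a : EuclideanSpace ℝ (Fin n)} {μ : Measure (EuclideanSpace ℝ (Fin n))}
    [IsProbabilityMeasure μ] {ρ : EuclideanSpace ℝ (Fin n) → ℝ} (hℓ : 0 < ℓ) (hR : 1 ≤ R)
    (hQ : Q = {x | ∀ i, x i ∈ Ioo (a i) (a i + ℓ)} ∨ Q = {x | ∀ i, x i ∈ Icc (a i) (a i + ℓ)})
    (hμ : HasDensityOn μ Q ρ) (hρ0 : ∀ x ∈ Q, 0 ≤ ρ x)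
    (hlc : CoordLogConcave (Set.pi univ fun i => Ioo (a i) (a i + ℓ))
      fun x => ρ (WithLp.toLp 2 x))
    (hcx : CoordConvexUpTo R (fun i => Ioo (a i) (a i + ℓ)) fun x => ρ (WithLp.toLp 2 x)) :
    (∀ f : EuclideanSpace ℝ (Fin n) → ℝ, LipschitzOnWith 1 f Q →
      IntegrableOn f Q μ ∧ ∀ t : ℝ, 0 < t →
        μ.real {x ∈ Q | t ≤ |f x - ∫ y in Q, f y ∂μ|} ≤
          8 * Real.exp (-(1 / 4 * t ^ 2 / (3 * ℓ * R) ^ 2))) ∧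
    ((8 * (3 * ℓ * R) ^ 2) • (1 : Matrix (Fin n) (Fin n) ℝ) - covMatrix μ).PosSemidef := by
  have hR0 : 0 < R := by linarith
  have hV0 : 0 < 16 * R * ℓ ^ 2 := by positivity
  set V := (16 * R * ℓ ^ 2).toNNReal with hV
  have hVc : (V : ℝ) = 16 * R * ℓ ^ 2 := Real.coe_toNNReal _ hV0.le
  have hVle : 4 * (16 * R * ℓ ^ 2) ≤ 8 * (3 * ℓ * R) ^ 2 := by
    have : R * ℓ ^ 2 ≤ R ^ 2 * ℓ ^ 2 := mul_le_mul_of_nonneg_right (by nlinarith) (sq_nonneg _)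
    nlinarith [mul_pos hR0 (pow_pos hℓ 2)]
  have hsub : ∀ f : EuclideanSpace ℝ (Fin n) → ℝ, LipschitzOnWith 1 f Q → Integrable f μ ∧
      HasSubgaussianMGF (fun x => f x - ∫ y, f y ∂μ) V μ := fun f hf =>
    hasSubgaussianMGF_of_hasDensityOn hℓ hR hQ hμ hρ0 hlc hcx hf
  have hQm : MeasurableSet Q := by
    rcases hQ with rfl | rfl
    · rw [Set.ofPred_forall]
      exact MeasurableSet.iInter fun i => measurableSet_Ioo.preimage (by fun_prop)
    · rw [Set.ofPred_forall]
      exact MeasurableSet.iInter fun i => measurableSet_Icc.preimage (by fun_prop)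
  have hμQ : μ.restrict Q = μ := by
    refine Measure.restrict_eq_self_of_ae_mem ?_
    rw [hμ]
    exact (withDensity_absolutelyContinuous _ _).ae_le (ae_restrict_mem hQm)
  constructor
  · intro f hf
    obtain ⟨hfi, hfs⟩ := hsub f hf
    rw [hμQ]
    refine ⟨hfi.integrableOn, fun t ht => ?_⟩
    have h1 := hfs.measure_ge_le ht.le
    have h2 := hfs.neg.measure_ge_le ht.le
    have hexp : Real.exp (-t ^ 2 / (2 * V)) ≤ Real.exp (-(1 / 4 * t ^ 2 / (3 * ℓ * R) ^ 2)) := by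
      refine Real.exp_le_exp.2 ?_
      rw [neg_div, neg_le_neg_iff, hVc, div_le_div_iff₀ (by positivity) (by positivity)]
      have := mul_le_mul_of_nonneg_left hVle (sq_nonneg t)
      nlinarith [sq_nonneg t]
    have hpos := Real.exp_pos (-(1 / 4 * t ^ 2 / (3 * ℓ * R) ^ 2))
    calc μ.real {x ∈ Q | t ≤ |f x - ∫ y, f y ∂μ|}
        ≤ μ.real ({x | t ≤ f x - ∫ y, f y ∂μ}
          ∪ {x | t ≤ (-fun x => f x - ∫ y, f y ∂μ) x}) := by
          refine measureReal_mono fun x hx => ?_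
          rcases le_abs.1 hx.2 with h | h
          · exact Or.inl h
          · exact Or.inr h
      _ ≤ _ := measureReal_union_le _ _
      _ ≤ 8 * Real.exp (-(1 / 4 * t ^ 2 / (3 * ℓ * R) ^ 2)) := by linarith
  · have hcoord : ∀ i, MemLp (fun x : EuclideanSpace ℝ (Fin n) => x i) 2 μ := by
      intro i
      have hL : LipschitzOnWith 1 (fun x : EuclideanSpace ℝ (Fin n) => x i) Q :=
        LipschitzOnWith.of_dist_le_mul fun x _ y _ => by
          rw [NNReal.coe_one, one_mul, dist_eq_norm, dist_eq_norm]
          exact PiLp.norm_apply_le (x - y) i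
      have h2 := (hsub _ hL).2.memLp 2
      rw [ENNReal.coe_ofNat] at h2
      have := h2.add (memLp_const (∫ y, y i ∂μ))
      convert this using 1
      ext x; simp
    refine Matrix.PosSemidef.of_dotProduct_mulVec_nonneg ?_ fun θ => ?_
    · ext i j
      have h1 : (1 : Matrix (Fin n) (Fin n) ℝ) j i = (1 : Matrix (Fin n) (Fin n) ℝ) i j := by
        rw [← Matrix.transpose_apply (1 : Matrix (Fin n) (Fin n) ℝ), Matrix.transpose_one]
      simp [covMatrix, h1, covariance_comm (fun x : EuclideanSpace ℝ (Fin n) => x j)]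
    · set w : EuclideanSpace ℝ (Fin n) := WithLp.toLp 2 θ with hw
      have hnorm : ‖w‖ ^ 2 = ∑ i, θ i ^ 2 := EuclideanSpace.real_norm_sq_eq w
      have hvar : ∑ i, ∑ j, θ i * θ j * cov[fun x => x i, fun x => x j; μ]
          = Var[fun x : EuclideanSpace ℝ (Fin n) => ∑ i, θ i * x i; μ] := by
        rw [← covariance_self (Finset.aemeasurable_fun_sum _ fun i _ =>
            (hcoord i).aestronglyMeasurable.aemeasurable.const_mul _),
          covariance_fun_sum_fun_sum (fun i => (hcoord i).const_mul _)
            fun i => (hcoord i).const_mul _]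
        refine Finset.sum_congr rfl fun i _ => Finset.sum_congr rfl fun j _ => ?_
        rw [covariance_const_mul_left, covariance_const_mul_right, mul_assoc]
      have hquad : star θ ⬝ᵥ (((8 * (3 * ℓ * R) ^ 2) • (1 : Matrix (Fin n) (Fin n) ℝ)
          - covMatrix μ).mulVec θ) = 8 * (3 * ℓ * R) ^ 2 * ‖w‖ ^ 2
            - Var[fun x : EuclideanSpace ℝ (Fin n) => ∑ i, θ i * x i; μ] := by
        rw [← hvar, hnorm, Matrix.sub_mulVec, Matrix.smul_mulVec, Matrix.one_mulVec,
          dotProduct_sub, dotProduct_smul]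
        simp only [star_trivial, dotProduct, Matrix.mulVec, covMatrix, Matrix.of_apply,
          smul_eq_mul, Finset.mul_sum]
        congr 1
        · refine Finset.sum_congr rfl fun i _ => by ring
        · refine Finset.sum_congr rfl fun i _ => Finset.sum_congr rfl fun j _ => by ring
      rw [hquad, sub_nonneg]
      rcases eq_or_ne ‖w‖ 0 with hw0 | hw0
      · have hθ : ∀ i, θ i = 0 := fun i => by
          have : w = 0 := norm_eq_zero.1 hw0
          have := congrArg (fun v : EuclideanSpace ℝ (Fin n) => v i) this
          simpa [hw] using this
        simp only [hθ, hw0, zero_mul, Finset.sum_const_zero]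
        exact (variance_zero μ).le.trans (by simp)
      -- the normalised linear functional is Lipschitz
      have hL : LipschitzOnWith 1
          (fun x : EuclideanSpace ℝ (Fin n) => ‖w‖⁻¹ * ∑ i, θ i * x i) Q := by
        refine LipschitzOnWith.of_dist_le_mul fun x _ y _ => ?_
        have hin : ‖w‖⁻¹ * ∑ i, θ i * x i - ‖w‖⁻¹ * ∑ i, θ i * y i
            = ‖w‖⁻¹ * inner ℝ w (x - y) := by
          rw [← mul_sub, ← Finset.sum_sub_distrib, PiLp.inner_apply]
          congr 1
          refine Finset.sum_congr rfl fun i _ => ?_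
          simp [hw]; ring
        rw [Real.dist_eq, hin, abs_mul, abs_of_nonneg (by positivity), NNReal.coe_one, one_mul,
          dist_eq_norm, inv_mul_le_iff₀ (by positivity)]
        exact abs_real_inner_le_norm _ _
      have hVpos : 0 < V := Real.toNNReal_pos.2 hV0
      have hfs := hsub _ hL
      have hvar' := HasSubgaussianMGF.integral_sq_le hVpos hfs.2
      rw [← variance_eq_integral hfs.1.aestronglyMeasurable.aemeasurable, variance_const_mul,
        inv_pow, inv_mul_le_iff₀ (by positivity), hVc] at hvar'
      calc _ ≤ ‖w‖ ^ 2 * (4 * (16 * R * ℓ ^ 2)) := hvar'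
        _ ≤ ‖w‖ ^ 2 * (8 * (3 * ℓ * R) ^ 2) := mul_le_mul_of_nonneg_left hVle (sq_nonneg _)
        _ = _ := mul_comm _ _

theorem mainTheorem7 :
    ∃ c C : ℝ, 0 < c ∧ 0 < C ∧
      ∀ (n : ℕ) (Q : Set (EuclideanSpace ℝ (Fin n)))
        (μ : Measure (EuclideanSpace ℝ (Fin n))) [IsProbabilityMeasure μ] (α : ℝ),
        ((∃ (ℓ M : ℝ) (ψ : EuclideanSpace ℝ (Fin n) → ℝ),
            0 < ℓ ∧ 0 ≤ M ∧ IsAxisCube ℓ Q ∧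
            HasDensityOn μ Q (fun x => Real.exp (-ψ x)) ∧
            ConvexOn ℝ Q ψ ∧ PureSecondDerivLE M Q ψ ∧
            α = 3 * ℓ * Real.exp (M * ℓ ^ 2 / 8)) ∨
          (∃ (R : ℝ) (ρ : EuclideanSpace ℝ (Fin n) → ℝ),
            1 ≤ R ∧ IsAxisCube 1 Q ∧
            HasDensityOn μ Q ρ ∧ IsLogConcaveOn Q ρ ∧ AxisConvexUpTo R Q ρ ∧
            α = 3 * R)) →
        (∀ f : EuclideanSpace ℝ (Fin n) → ℝ, LipschitzOnWith 1 f Q →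
          IntegrableOn f Q μ ∧
          ∀ t : ℝ, 0 < t →
            μ.real {x ∈ Q | t ≤ |f x - ∫ y in Q, f y ∂μ|} ≤
              C * Real.exp (-(c * t ^ 2 / α ^ 2))) ∧
        ((C * α ^ 2) • (1 : Matrix (Fin n) (Fin n) ℝ) - covMatrix μ).PosSemidef := by
  refine ⟨1 / 4, 8, by norm_num, by norm_num, ?_⟩
  rintro n Q μ _ α (⟨ℓ, M, ψ, hℓ, hM, ⟨a, hQ⟩, hμ, hψ, hψ'', rfl⟩ |
    ⟨R, ρ, hR, ⟨a, hQ⟩, hμ, hρ, hax, rfl⟩)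
  · obtain ⟨hlc, hcx⟩ := exp_neg_logConcave_and_convexUpTo hM hQ hψ hψ''
    exact concentration_and_covMatrix_le hℓ (Real.one_le_exp (by positivity)) hQ hμ
      (fun x _ => (Real.exp_pos _).le) hlc hcx
  · obtain ⟨hlc, hcx⟩ := logConcave_and_convexUpTo_of_axis hQ hρ hax
    have := concentration_and_covMatrix_le zero_lt_one hR hQ hμ hρ.2.1 hlc hcx
    rwa [mul_one] at this
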